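/- Write $e(x)=e^{2\pi i x}$ and, for $z\in\mathbb{C}$, $\tau\in\mathbb{H}$, $p=e(z)$, $q=e(\tau)$. Let $E_2,E_4,E_6$ be the Eisenstein series of level $1$ normalized to have constant term $1$, let $\Delta=q\prod_{n\ge1}(1-q^n)^{24}$, and let $$\wp(z,\tau)=\frac{1}{(2\pi i)^2}\Big(\frac1{z^2}+\sum_{\omega\in(\mathbb{Z}+\mathbb{Z}\tau)\setminus\{0\}}\Big(\frac{1}{(z-\omega)^2}-\frac1{\omega^2}\Big)\Big).$$ For $k\in\{4,6\}$ let $$E_{k,1}(z,\tau)=\frac12\sum_{\substack{c,d\in\mathbb{Z}\\ \gcd(c,d)=1}}(c\tau+d)^{-k}\sum_{\ell\in\mathbb{Z}}e\Big(\ell^2\,\frac{a\tau+b}{c\tau+d}+\frac{2\ell z}{c\tau+d}-\frac{cz^2}{c\tau+d}\Big)$$ be the Jacobi–Eisenstein series of weight $k$ and index $1$, where $a,b\in\mathbb{Z}$ are chosen with $ad-bc=1$, and let $$\phi_{-2,1}=\frac{E_6E_{4,1}-E_4E_{6,1}}{144\,\Delta},\qquad \phi_{0,1}=\frac{E_4^2E_{4,1}-E_6E_{6,1}}{144\,\Delta}.$$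 Define $$E_{2,1}(z,\tau)=\phi_{-2,1}(z,\tau)\Big(E_2(\tau)\wp(z,\tau)-\frac1{12}E_4(\tau)\Big),$$ where at the points $z\in\mathbb{Z}+\mathbb{Z}\tau$ (the poles of $\wp$) the value is the limit of the right-hand side. **Lemma.** The limits just mentioned exist, and: (a) $E_{2,1}$ is holomorphic on $\mathbb{C}\times\mathbb{H}$. (b) There are complex numbers $c(n,r)$ ($n\ge 0$, $r\in\mathbb{Z}$) with $c(n,r)=0$ whenever $r^2>4n$ such that for all $(z,\tau)\in\mathbb{C}\times\mathbb{H}$, with absolute convergence, $$E_{2,1}(z,\tau)=\sum_{n\ge0}\ \sum_{\substack{r\in\mathbb{Z}\\ r^2\le4n}}c(n,r)\,p^rq^n.$$ (c) For all $(z,\tau)\in\mathbb{C}\times\mathbb{H}$ and $\lambda,\mu\in\mathbb{Z}$, $$E_{2,1}(z+\lambda\tau+\mu,\tau)=e^{-2\pi i(\lambda^2\tau+2\lambda z)}E_{2,1}(z,\tau),$$ and $$E_{2,1}(z/\tau,-1/\tau)=e^{\frac{2\pi i z^2}{\tau}}\tau^2E_{2,1}(z,\tau)+\frac{1}{2\pi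 i}e^{\frac{2\pi i z^2}{\tau}}\tau\,\phi_{0,1}(z,\tau).$$ (d) $E_{2,1}(0,\tau)=E_2(\tau)$ for all $\tau\in\mathbb{H}$. -/

import Mathlib

open scoped Topology UpperHalfPlane

noncomputable section

namespace JacobiE2

/-- The Jacobi-Eisenstein series of weight `k` and index `1`,
`E_{k,1}(z, τ) = (1/2) ∑_{(c, d) = 1} ∑_{l ∈ ℤ} (c τ + d)^{-k} e(l² γτ + 2 l z / (c τ + d) - c z² / (c τ + d))`,
where `e(x) = exp (2 π i x)`, `(c, d) = (v 0, v 1)` runs over all coprime pairs of integers, and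
`γ = (a, b; c, d)` is a matrix in `SL(2, ℤ)` with bottom row `(c, d)`. The choice of `γ` does not
matter, since another choice changes `γτ` by an integer. Here `a` and `b` are the Bezout
coefficients, `a d - b c = 1`. -/
def jacobiEisenstein (k : ℤ) (z : ℂ) (τ : ℍ) : ℂ :=
  (1 / 2) * ∑' v : {v : Fin 2 → ℤ // IsCoprime (v 0) (v 1)},
    ((v.1 0 : ℂ) * τ + v.1 1) ^ (-k) *
      ∑' l : ℤ, Complex.exp (2 * Real.pi * Complex.I *
        ((l : ℂ) ^ 2 * (((Int.gcdB (v.1 0) (v.1 1) : ℂ) * τ - (Int.gcdA (v.1 0) (v.1 1) : ℂ)) /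
            ((v.1 0 : ℂ) * τ + v.1 1))
          + 2 * (l : ℂ) * z / ((v.1 0 : ℂ) * τ + v.1 1)
          - (v.1 0 : ℂ) * z ^ 2 / ((v.1 0 : ℂ) * τ + v.1 1)))

/-- The Jacobi cusp form `φ_{10,1} = (E₆ E_{4,1} - E₄ E_{6,1}) / 144` of Eichler and Zagier. -/
def phi10 (z : ℂ) (τ : ℍ) : ℂ :=
  (ModularForm.E₆ τ * jacobiEisenstein 4 z τ - ModularForm.E₄ τ * jacobiEisenstein 6 z τ) / 144

/-- The Jacobi cusp form `φ_{12,1} = (E₄² E_{4,1} - E₆ E_{6,1}) / 144` of Eichler and Zagier. -/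
def phi12 (z : ℂ) (τ : ℍ) : ℂ :=
  (ModularForm.E₄ τ ^ 2 * jacobiEisenstein 4 z τ - ModularForm.E₆ τ * jacobiEisenstein 6 z τ) / 144

/-- The weak Jacobi form `φ_{-2,1} = φ_{10,1} / Δ`. -/
def phiNegTwo (z : ℂ) (τ : ℍ) : ℂ := phi10 z τ / ModularForm.discriminant τ

/-- The weak Jacobi form `φ_{0,1} = φ_{12,1} / Δ`. -/
def phiZero (z : ℂ) (τ : ℍ) : ℂ := phi12 z τ / ModularForm.discriminant τ

theorem linearIndependent_one_tau (τ : ℍ) : LinearIndependent ℝ ![(1 : ℂ), (τ : ℂ)] := by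
  rw [LinearIndependent.pair_iff]
  intro s t h
  have him := congrArg Complex.im h
  have hre := congrArg Complex.re h
  have ht : t = 0 := by
    have : t * τ.im = 0 := by simpa using him
    exact (mul_eq_zero.mp this).resolve_right τ.im_pos.ne'
  subst ht
  exact ⟨by simpa using hre, rfl⟩

/-- The periods `1, τ`, spanning the lattice `ℤ + ℤ τ`. -/
def periods (τ : ℍ) : PeriodPair where
  ω₁ := 1
  ω₂ := τ
  indep := linearIndependent_one_tau τ

/-- The Weierstrass function of the lattice `ℤ + ℤ τ`, normalized as
`℘(z, τ) = (2 π i)⁻² (1 / z² + O(z²))`. -/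
def wp (z : ℂ) (τ : ℍ) : ℂ := (2 * Real.pi * Complex.I) ^ (-2 : ℤ) * (periods τ).weierstrassP z

/-- The expression `φ_{-2,1} (E₂ ℘ - E₄ / 12)`, meaningful for `z` outside the lattice `ℤ + ℤ τ`,
where `℘` has its poles. -/
def preE21 (z : ℂ) (τ : ℍ) : ℂ :=
  phiNegTwo z τ * (EisensteinSeries.E2 τ * wp z τ - 1 / 12 * ModularForm.E₄ τ)

open Classical in
/-- The function `E_{2,1} = φ_{-2,1} (E₂ ℘ - E₄ / 12)`. At the lattice points `z ∈ ℤ + ℤ τ`, where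
the formula reads `0 * ∞`, its value is the limit of the formula. -/
def E21 (z : ℂ) (τ : ℍ) : ℂ :=
  if z ∈ (periods τ).lattice then Filter.limUnder (𝓝[≠] z) (fun u => preE21 u τ) else preE21 z τ

end JacobiE2

end

open scoped Topology UpperHalfPlane

noncomputable section

namespace JacobiE2

open Filter
open scoped Real Manifold MatrixGroups ModularForm

/-! The heart of the matter is the identity φ_{0,1} = 12 φ_{-2,1} ℘ off the lattice
(`PhiDecomp.phiZero_eq_mul_wp`). It turns the definition into E_{2,1} = (E₂ φ_{0,1} - E₄ φ_{-2,1}) /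
12, an expression without poles from which every claim can be read off.

An entire function with the quasi-periodicity of index 1 is u θ₀ + v θ₁ (`exists_eq_theta`), where
θ_ε is the sum of q^((r² - ε²)/4) p^r over r ≡ ε mod 2. This space is two-dimensional, and where the
Wronskian of θ₀, θ₁ at z = 0 is nonzero, an element is determined by its Taylor coefficients of
orders 0 and 2. In the variable τ these coefficients are modular up to an anomaly that E₂
compensates; subtracting the expected Eisenstein expression leaves a cusp form of weight below 12,
hence zero (`IsWeaklyModular.eq_zero`). With s = 2πi this gives φ_{0,1} = 12 + s² E₂ z² + ... and
φ_{-2,1} = s² z² + s⁴ E₂ z⁴ / 12 + ..., and the same numbers force the Wronskian to be nonzero.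
Since s² ℘ = 1/z² + o(1), the difference φ_{0,1} - 12 φ_{-2,1} ℘ extends to a theta function whose
coefficients of orders 0 and 2 vanish, so it is zero.

Holomorphy and the elliptic law pass to the combination. In the law for S the anomaly 12τ/(2πi) of
E₂, divided by 12, multiplies φ_{0,1}. At z = 0 the values 12 and 0 leave E₂. For the Fourier
support, q^m θ₀ has only terms with r² ≤ 4n, and q^m θ₁ violates this only for m = 0; the constant
term of the coefficient of θ₁ is 1/12 - 1/12 = 0. -/

/-! ### The theta functions of index one and their derivatives -/

/-- The general term of `theta`. -/
def thetaTerm (ε j : ℕ) (n : ℤ) (z τ : ℂ) : ℂ :=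
  (2 * n + ε : ℂ) ^ j *
    Complex.exp (2 * π * Complex.I * (((n : ℂ) ^ 2 + ε * n) * τ + (2 * n + ε) * z))

/-- The series `∑ r ^ j q ^ ((r ^ 2 - ε ^ 2) / 4) p ^ r` over the integers `r = 2 n + ε`. -/
def theta (ε j : ℕ) (z τ : ℂ) : ℂ := ∑' n : ℤ, thetaTerm ε j n z τ

/-- A summable majorant of `thetaTerm` on `|Im z| ≤ S`, `T ≤ Im τ`. -/
def thetaBound (j : ℕ) (S T : ℝ) (n : ℤ) : ℝ :=
  3 ^ j * Real.exp (2 * π * S) *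
    ((|n| : ℝ) ^ j * Real.exp (-π * (2 * T * n ^ 2 - 2 * (T + 2 * S) * |n|)) +
      (|n| : ℝ) ^ 0 * Real.exp (-π * (2 * T * n ^ 2 - 2 * (T + 2 * S) * |n|)))

theorem summable_thetaBound (j : ℕ) (S : ℝ) {T : ℝ} (hT : 0 < T) :
    Summable (thetaBound j S T) := by
  have h := ((summable_pow_mul_jacobiTheta₂_term_bound (T + 2 * S) (mul_pos two_pos hT) j).add
    (summable_pow_mul_jacobiTheta₂_term_bound (T + 2 * S) (mul_pos two_pos hT) 0)).mul_left
      (3 ^ j * Real.exp (2 * π * S))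
  exact h.congr fun n => by simp only [thetaBound, Int.cast_abs]

/-- As ε is 0 or 1, n² + εn ≥ n² - |n| ≥ 0, so Im τ may be replaced by its lower bound T; the term
linear in z costs at most (2|n| + 1) S. -/
theorem norm_thetaTerm_le {ε : ℕ} (hε : ε ≤ 1) (j : ℕ) {S T : ℝ} (hT : 0 < T) {z τ : ℂ}
    (hz : |z.im| ≤ S) (hτ : T ≤ τ.im) (n : ℤ) :
    ‖thetaTerm ε j n z τ‖ ≤ thetaBound j S T n := by
  have hn : (0 : ℝ) ≤ |(n : ℝ)| := abs_nonneg _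
  have hS : 0 ≤ S := (abs_nonneg _).trans hz
  have hε0 : (0 : ℝ) ≤ ε := Nat.cast_nonneg _
  have hε1 : (ε : ℝ) ≤ 1 := by exact_mod_cast hε
  have h1 : ‖(2 * n + ε : ℂ) ^ j‖ ≤ 3 ^ j * ((|n| : ℝ) ^ j + (|n| : ℝ) ^ 0) := by
    rw [norm_pow]
    have h2 : ‖(2 * n + ε : ℂ)‖ ≤ 3 * max (|n| : ℝ) 1 := by
      calc ‖(2 * n + ε : ℂ)‖ ≤ ‖(2 * n : ℂ)‖ + ‖(ε : ℂ)‖ := norm_add_le _ _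
        _ = 2 * |(n : ℝ)| + ε := by simp
        _ ≤ 3 * max (|n| : ℝ) 1 := by
          linarith [le_max_left (|n| : ℝ) 1, le_max_right (|n| : ℝ) 1]
    calc ‖(2 * n + ε : ℂ)‖ ^ j ≤ (3 * max (|n| : ℝ) 1) ^ j := by gcongr
      _ = 3 ^ j * (max (|n| : ℝ) 1) ^ j := mul_pow _ _ _
      _ ≤ _ := by
        gcongr
        rcases max_cases (|n| : ℝ) 1 with h | h <;> rw [h.1] <;> simp
  have hint : (0 : ℝ) ≤ (n : ℝ) ^ 2 - |(n : ℝ)| := by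
    have : (|n| : ℤ) ≤ n ^ 2 := by
      rw [← sq_abs]
      nlinarith [abs_nonneg n, Int.abs_lt_one_iff (a := n), sq_abs n,
        (by rcases eq_or_ne n 0 with h | h
            · simp [h]
            · have := Int.one_le_abs h; nlinarith : |n| ≤ |n| ^ 2)]
    have h' : ((|n| : ℤ) : ℝ) ≤ ((n ^ 2 : ℤ) : ℝ) := by exact_mod_cast this
    push_cast at h'
    linarith
  have hen : -|(n : ℝ)| ≤ ε * n := by
    have := neg_abs_le (n : ℝ)
    nlinarith [abs_nonneg (n : ℝ)]
  have hzn : -((2 * |(n : ℝ)| + 1) * S) ≤ (2 * n + ε) * z.im := by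
    have h3 : |(2 * n + ε) * z.im| ≤ (2 * |(n : ℝ)| + 1) * S := by
      rw [abs_mul]
      gcongr
      calc |2 * (n : ℝ) + ε| ≤ |2 * (n : ℝ)| + |(ε : ℝ)| := abs_add_le _ _
        _ ≤ _ := by rw [abs_mul, abs_of_nonneg hε0]; simp; linarith
    exact (neg_le_neg h3).trans (neg_abs_le _)
  have h4 : ‖Complex.exp (2 * π * Complex.I * (((n : ℂ) ^ 2 + ε * n) * τ + (2 * n + ε) * z))‖ ≤
      Real.exp (2 * π * S) *
        Real.exp (-π * (2 * T * n ^ 2 - 2 * (T + 2 * S) * |(n : ℝ)|)) := by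
    rw [Complex.norm_exp, ← Real.exp_add, Real.exp_le_exp]
    have : (2 * π * Complex.I * (((n : ℂ) ^ 2 + ε * n) * τ + (2 * n + ε) * z)).re =
        -(2 * π) * (((n : ℝ) ^ 2 + ε * n) * τ.im + (2 * n + ε) * z.im) := by
      have : (2 * π * Complex.I * (((n : ℂ) ^ 2 + ε * n) * τ + (2 * n + ε) * z)) =
        ((2 * π : ℝ) : ℂ) * ((((n : ℝ) ^ 2 + ε * n : ℝ) : ℂ) * τ +
          ((2 * n + ε : ℝ) : ℂ) * z) * Complex.I := by push_cast; ring
      rw [this, Complex.mul_I_re, Complex.im_ofReal_mul, Complex.add_im, Complex.im_ofReal_mul,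
        Complex.im_ofReal_mul]
      ring
    rw [this]
    have key : ((n : ℝ) ^ 2 - |(n : ℝ)|) * T - (2 * |(n : ℝ)| + 1) * S ≤
        (((n : ℝ) ^ 2 + ε * n) * τ.im + (2 * n + ε) * z.im) := by
      have : ((n : ℝ) ^ 2 - |(n : ℝ)|) * T ≤ ((n : ℝ) ^ 2 + ε * n) * τ.im := by
        apply mul_le_mul _ hτ hT.le
        · linarith
        · linarith
      linarith
    have := mul_le_mul_of_nonneg_left key (by positivity : 0 ≤ 2 * π)
    nlinarith
  rw [thetaTerm, norm_mul, thetaBound]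
  calc _ ≤ (3 ^ j * ((|n| : ℝ) ^ j + (|n| : ℝ) ^ 0)) * (Real.exp (2 * π * S) *
        Real.exp (-π * (2 * T * n ^ 2 - 2 * (T + 2 * S) * |(n : ℝ)|))) := by gcongr
    _ = _ := by push_cast; ring

theorem summable_thetaTerm {ε : ℕ} (hε : ε ≤ 1) (j : ℕ) (z : ℂ) {τ : ℂ} (hτ : 0 < τ.im) :
    Summable (fun n => thetaTerm ε j n z τ) :=
  (summable_thetaBound j _ hτ).of_norm_bounded
    (fun n => norm_thetaTerm_le hε j hτ le_rfl le_rfl n)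

theorem hasDerivAt_thetaTerm (ε j : ℕ) (n : ℤ) (z τ : ℂ) :
    HasDerivAt (fun w => thetaTerm ε j n w τ)
      (2 * π * Complex.I * thetaTerm ε (j + 1) n z τ) z := by
  unfold thetaTerm
  have h := ((((hasDerivAt_id z).const_mul (2 * n + ε : ℂ)).const_add
    (((n : ℂ) ^ 2 + ε * n) * τ)).const_mul (2 * π * Complex.I)).cexp.const_mul
      ((2 * n + ε : ℂ) ^ j)
  convert! h using 1
  simp only [id]
  ring

/-- Normal convergence on horizontal strips permits termwise differentiation; each derivative brings
down 2πi (2n + ε), which is why the power j is carried along. -/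
theorem hasDerivAt_theta {ε : ℕ} (hε : ε ≤ 1) (j : ℕ) (z : ℂ) {τ : ℂ} (hτ : 0 < τ.im) :
    HasDerivAt (fun w => theta ε j w τ) (2 * π * Complex.I * theta ε (j + 1) z τ) z := by
  have hU : IsOpen {w : ℂ | |w.im| < |z.im| + 1} :=
    isOpen_lt (by fun_prop) continuous_const
  have hd : ∀ n : ℤ, DifferentiableOn ℂ (fun w => thetaTerm ε j n w τ)
      {w : ℂ | |w.im| < |z.im| + 1} := fun n w _ =>
    (hasDerivAt_thetaTerm ε j n w τ).differentiableAt.differentiableWithinAt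
  have hb : ∀ (n : ℤ) (w : ℂ), w ∈ {w : ℂ | |w.im| < |z.im| + 1} →
      ‖thetaTerm ε j n w τ‖ ≤ thetaBound j (|z.im| + 1) τ.im n := fun n w hw =>
    norm_thetaTerm_le hε j hτ (le_of_lt hw) le_rfl n
  have hs := summable_thetaBound j (|z.im| + 1) hτ
  have hz : z ∈ {w : ℂ | |w.im| < |z.im| + 1} := by simp
  have h1 := Complex.hasSum_deriv_of_summable_norm hs hd hU hb hz
  have h2 := (Complex.differentiableOn_tsum_of_summable_norm hs hd hU hb).differentiableAt
    (hU.mem_nhds hz)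
  have h3 : deriv (fun w => ∑' n : ℤ, thetaTerm ε j n w τ) z =
      2 * π * Complex.I * theta ε (j + 1) z τ := by
    rw [← h1.tsum_eq, theta, ← tsum_mul_left]
    exact tsum_congr fun n => (hasDerivAt_thetaTerm ε j n z τ).deriv
  rw [← h3]
  exact h2.hasDerivAt

theorem differentiableAt_theta_right {ε : ℕ} (hε : ε ≤ 1) (j : ℕ) (z : ℂ) {τ : ℂ}
    (hτ : 0 < τ.im) : DifferentiableAt ℂ (fun t => theta ε j z t) τ := by
  have hU : IsOpen {t : ℂ | τ.im / 2 < t.im} := isOpen_lt continuous_const (by fun_prop)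
  refine (Complex.differentiableOn_tsum_of_summable_norm
    (summable_thetaBound j |z.im| (half_pos hτ)) (fun n => ?_) hU
    (fun n t ht => norm_thetaTerm_le hε j (half_pos hτ) le_rfl (le_of_lt ht) n)).differentiableAt
    (hU.mem_nhds ?_)
  · unfold thetaTerm
    fun_prop
  · simpa using hτ

theorem thetaTerm_add_one (ε j : ℕ) (n : ℤ) (z τ : ℂ) :
    thetaTerm ε j n (z + 1) τ = thetaTerm ε j n z τ := by
  unfold thetaTerm
  congr 1
  rw [Complex.exp_eq_exp_iff_exists_int]
  exact ⟨2 * n + ε, by push_cast; ring⟩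

theorem theta_add_one (ε j : ℕ) (z τ : ℂ) : theta ε j (z + 1) τ = theta ε j z τ :=
  tsum_congr fun n => thetaTerm_add_one ε j n z τ

theorem theta_right_add_one (ε j : ℕ) (z τ : ℂ) : theta ε j z (τ + 1) = theta ε j z τ := by
  refine tsum_congr fun n => ?_
  unfold thetaTerm
  congr 1
  rw [Complex.exp_eq_exp_iff_exists_int]
  exact ⟨n ^ 2 + ε * n, by push_cast; ring⟩

/-- Completing the square: adding τ to z amounts to replacing n by n + 1. -/
theorem theta_add_tau (ε : ℕ) (z τ : ℂ) :
    theta ε 0 (z + τ) τ = Complex.exp (2 * π * Complex.I * (-τ - 2 * z)) * theta ε 0 z τ := by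
  rw [theta, theta, ← tsum_mul_left, ← (Equiv.addRight (1 : ℤ)).tsum_eq
    (fun n => Complex.exp (2 * π * Complex.I * (-τ - 2 * z)) * thetaTerm ε 0 n z τ)]
  refine tsum_congr fun n => ?_
  simp only [thetaTerm, pow_zero, one_mul, ← Complex.exp_add, Equiv.coe_addRight]
  congr 1
  push_cast
  ring

/-- The translation by 1/2 multiplies p^r by (-1)^r, so it separates the two parities. -/
theorem theta_add_half (ε : ℕ) (z τ : ℂ) :
    theta ε 0 (z + 1 / 2) τ = (-1) ^ ε * theta ε 0 z τ := by
  rw [theta, theta, ← tsum_mul_left]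
  refine tsum_congr fun n => ?_
  have : Complex.exp (2 * π * Complex.I * n) = 1 := by
    rw [mul_comm]; exact Complex.exp_int_mul_two_pi_mul_I n
  have h2 : Complex.exp (ε * (π * Complex.I)) = (-1) ^ ε := by
    rw [Complex.exp_nat_mul, Complex.exp_pi_mul_I]
  rw [← h2]
  simp only [thetaTerm, pow_zero, one_mul]
  rw [← Complex.exp_add, Complex.exp_eq_exp_iff_exists_int]
  exact ⟨n, by ring⟩

/-- The substitution n ↦ -ε - n changes the sign of r = 2n + ε and keeps the exponent of q. -/
theorem theta_zero_of_odd (ε : ℕ) {j : ℕ} (hj : Odd j) (τ : ℂ) : theta ε j 0 τ = 0 := by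
  have : theta ε j 0 τ = -theta ε j 0 τ := by
    conv_lhs => rw [theta, ← (Equiv.subLeft (-(ε : ℤ))).tsum_eq]
    rw [theta, ← tsum_neg]
    refine tsum_congr fun n => ?_
    simp only [thetaTerm, Equiv.subLeft_apply, mul_zero, add_zero]
    push_cast
    rw [← neg_mul, ← hj.neg_pow]
    ring_nf
  simpa [self_eq_neg] using this

/-! ### Theta constants at the cusp. -/

theorem tendsto_cexp_mul_atImInfty {m : ℤ} (hm : 0 < m) :
    Tendsto (fun τ : ℍ => Complex.exp (2 * π * Complex.I * (m * (τ : ℂ))))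
      UpperHalfPlane.atImInfty (𝓝 0) := by
  rw [tendsto_zero_iff_norm_tendsto_zero]
  have h : ∀ τ : ℍ, ‖Complex.exp (2 * π * Complex.I * (m * (τ : ℂ)))‖ =
      Real.exp (-((2 * π * m) * τ.im)) := fun τ => by
    rw [Complex.norm_exp]
    congr 1
    have : 2 * π * Complex.I * (m * (τ : ℂ)) = ((2 * π * m : ℝ) : ℂ) * τ * Complex.I := by
      push_cast; ring
    rw [this, Complex.mul_I_re, Complex.im_ofReal_mul, UpperHalfPlane.coe_im]
  simp only [h]
  have hm' : (0 : ℝ) < m := by exact_mod_cast hm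
  exact Real.tendsto_exp_neg_atTop_nhds_zero.comp
    (tendsto_comap.const_mul_atTop (by positivity))

theorem tendsto_theta_zero_atImInfty {ε : ℕ} (hε : ε ≤ 1) (j : ℕ) :
    Tendsto (fun τ : ℍ => theta ε j 0 τ) UpperHalfPlane.atImInfty
      (𝓝 (∑' n : ℤ, if n ^ 2 + ε * n = 0 then (2 * n + ε : ℂ) ^ j else 0)) := by
  refine tendsto_tsum_of_dominated_convergence (summable_thetaBound j 0 one_pos) (fun n => ?_) ?_
  · split_ifs with h
    · refine tendsto_const_nhds.congr fun τ => ?_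
      have h' : (n : ℂ) ^ 2 + ε * n = 0 := by exact_mod_cast h
      simp [thetaTerm, h']
    · have h0 : 0 < n ^ 2 + ε * n := by
        refine lt_of_le_of_ne ?_ (Ne.symm h)
        interval_cases ε
        · simpa using sq_nonneg n
        · rcases le_or_gt 0 n with h | h
          · positivity
          · push_cast
            nlinarith
      have := (tendsto_cexp_mul_atImInfty h0).const_mul ((2 * n + ε : ℂ) ^ j)
      rw [mul_zero] at this
      refine this.congr fun τ => ?_
      simp [thetaTerm]
  · have : ∀ᶠ τ : ℍ in UpperHalfPlane.atImInfty, 1 ≤ τ.im :=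
      tendsto_comap.eventually (eventually_ge_atTop 1)
    filter_upwards [this] with τ hτ n
    exact norm_thetaTerm_le hε j one_pos (by simp) hτ n

theorem tendsto_theta_even_atImInfty (j : ℕ) :
    Tendsto (fun τ : ℍ => theta 0 j 0 τ) UpperHalfPlane.atImInfty (𝓝 (0 ^ j)) := by
  convert! tendsto_theta_zero_atImInfty (zero_le_one) j using 2
  rw [tsum_eq_single 0]
  · simp
  · intro n hn
    simp [hn]

theorem tendsto_theta_odd_atImInfty (j : ℕ) :
    Tendsto (fun τ : ℍ => theta 1 j 0 τ) UpperHalfPlane.atImInfty (𝓝 (1 + (-1) ^ j)) := by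
  convert! tendsto_theta_zero_atImInfty le_rfl j using 2
  -- n² + n = 0 exactly for n = 0 and n = -1, that is r = 1 and r = -1.
  rw [tsum_eq_sum (s := {0, -1})]
  · rw [Finset.sum_pair (by norm_num)]
    norm_num
  · intro n hn
    have h : n ^ 2 + ((1 : ℕ) : ℤ) * n ≠ 0 := by
      simp only [Finset.mem_insert, Finset.mem_singleton, not_or] at hn
      have : n ^ 2 + ((1 : ℕ) : ℤ) * n = n * (n + 1) := by push_cast; ring
      rw [this]
      exact mul_ne_zero hn.1 (fun h => hn.2 (by omega))
    rw [if_neg h]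

/-- Serves to import joint holomorphy in (z, τ) from `jacobiTheta₂`. -/
theorem theta_eq_jacobiTheta₂ (ε : ℕ) (z τ : ℂ) :
    theta ε 0 z τ =
      Complex.exp (2 * π * Complex.I * (ε * z)) * jacobiTheta₂ (2 * z + ε * τ) (2 * τ) := by
  rw [theta, jacobiTheta₂, ← tsum_mul_left]
  refine tsum_congr fun n => ?_
  rw [thetaTerm, jacobiTheta₂_term, ← Complex.exp_add, pow_zero, one_mul]
  congr 1
  ring

theorem differentiableAt_theta (ε : ℕ) {x : ℂ × ℂ} (hx : 0 < x.2.im) :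
    DifferentiableAt ℂ (fun x : ℂ × ℂ => theta ε 0 x.1 x.2) x := by
  simp only [theta_eq_jacobiTheta₂]
  have h : DifferentiableAt ℂ (fun p : ℂ × ℂ => jacobiTheta₂ p.1 p.2)
      (2 * x.1 + ε * x.2, 2 * x.2) :=
    (hasFDerivAt_jacobiTheta₂ _ (by simpa using hx)).differentiableAt
  refine DifferentiableAt.mul (by fun_prop) ?_
  exact h.comp x (f := fun x : ℂ × ℂ => (2 * x.1 + ε * x.2, 2 * x.2)) (by fun_prop)

theorem integral_cexp_int (m : ℤ) :
    ∫ x in (0 : ℝ)..1, Complex.exp (2 * π * Complex.I * (m * x)) = if m = 0 then 1 else 0 := by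
  split_ifs with h
  · simp [h]
  · have hc : (2 * π * Complex.I * m : ℂ) ≠ 0 :=
      mul_ne_zero Complex.two_pi_I_ne_zero (by exact_mod_cast h)
    have := integral_exp_mul_complex (a := 0) (b := 1) hc
    simp only [mul_assoc] at this ⊢
    rw [this]
    have h2 := Complex.exp_int_mul_two_pi_mul_I m
    rw [show (m : ℂ) * (2 * π * Complex.I) = 2 * (π * (Complex.I * m)) by ring] at h2
    simp [h2]

/-- The integral extracts the coefficient of p^ε, which is the term n = 0. In particular θ_ε(·, τ)
is not identically zero. -/
theorem integral_theta {ε : ℕ} (hε : ε ≤ 1) {τ : ℂ} (hτ : 0 < τ.im) :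
    ∫ x in (0 : ℝ)..1, Complex.exp (2 * π * Complex.I * (-(ε * x))) * theta ε 0 x τ = 1 := by
  let f : ℤ → C(ℝ, ℂ) := fun n =>
    ⟨fun x => Complex.exp (2 * π * Complex.I * (-(ε * x))) * thetaTerm ε 0 n x τ, by
      unfold thetaTerm; fun_prop⟩
  have hs : Summable fun n : ℤ => ‖(f n).restrict
      (⟨Set.uIcc (0 : ℝ) 1, isCompact_uIcc⟩ : TopologicalSpace.Compacts ℝ)‖ := by
    refine (summable_thetaBound 0 0 hτ).of_norm_bounded fun n => ?_
    rw [norm_norm]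
    refine (ContinuousMap.norm_le _ (by unfold thetaBound; positivity)).2 fun x => ?_
    rw [ContinuousMap.restrict_apply]
    simp only [f, ContinuousMap.coe_mk, norm_mul]
    have : ‖Complex.exp (2 * π * Complex.I * (-(ε * ((x : ℝ) : ℂ))))‖ = 1 := by
      rw [show 2 * π * Complex.I * (-(ε * ((x : ℝ) : ℂ))) =
        ((2 * π * (-(ε * (x : ℝ))) : ℝ) : ℂ) * Complex.I by push_cast; ring]
      exact Complex.norm_exp_ofReal_mul_I _
    rw [this, one_mul]
    exact norm_thetaTerm_le hε 0 hτ (by simp) le_rfl n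
  have h1 := intervalIntegral.tsum_intervalIntegral_eq_of_summable_norm hs
  have h2 : ∀ x : ℝ, ∑' n, f n x =
      Complex.exp (2 * π * Complex.I * (-(ε * x))) * theta ε 0 x τ := fun x => by
    simp only [f, ContinuousMap.coe_mk]
    rw [tsum_mul_left, theta]
  simp only [h2] at h1
  rw [← h1]
  have h3 : ∀ n : ℤ, ∫ x in (0 : ℝ)..1, f n x = if n = 0 then 1 else 0 := fun n => by
    have : ∀ x : ℝ, f n x = Complex.exp (2 * π * Complex.I * (((n : ℂ) ^ 2 + ε * n) * τ)) *
        Complex.exp (2 * π * Complex.I * ((2 * n : ℤ) * x)) := fun x => by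
      simp only [f, ContinuousMap.coe_mk, thetaTerm, pow_zero, one_mul, ← Complex.exp_add]
      congr 1
      push_cast
      ring
    simp only [this]
    rw [intervalIntegral.integral_const_mul, integral_cexp_int]
    rcases eq_or_ne n 0 with rfl | hn
    · simp
    · simp [hn]
  simp only [h3]
  simp

theorem exists_theta_ne_zero {ε : ℕ} (hε : ε ≤ 1) {τ : ℂ} (hτ : 0 < τ.im) :
    ∃ z : ℂ, theta ε 0 z τ ≠ 0 := by
  by_contra! h
  simpa [h] using integral_theta hε hτ

/-! ### The space of theta functions of index one -/

theorem hasSum_int_even_add_odd {f : ℤ → ℂ} {a b : ℂ} (he : HasSum (fun n => f (2 * n)) a)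
    (ho : HasSum (fun n => f (2 * n + 1)) b) : HasSum f (a + b) := by
  have h1 : Function.Injective (fun n : ℤ => 2 * n) := fun x y h => by
    simp only at h; omega
  have h2 : Function.Injective (fun n : ℤ => 2 * n + 1) := fun x y h => by
    simp only at h; omega
  have he' := h1.hasSum_range_iff.2 he
  have ho' := h2.hasSum_range_iff.2 ho
  refine HasSum.add_isCompl ?_ he' ho'
  rw [show (Set.range fun n : ℤ => 2 * n) = {n | Even n} by
      ext n; simp [even_iff_two_dvd, dvd_def],
    show (Set.range fun n : ℤ => 2 * n + 1) = {n | Odd n} by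
      ext n; simp [Odd]]
  exact Int.isCompl_even_odd

/-- With G a primitive of g, the integral is G(1 + w) - G(w), whose derivative in w vanishes by
periodicity. This plays the role of a contour shift. -/
theorem integral_add_eq_of_periodic {g : ℂ → ℂ} (hg : Differentiable ℂ g)
    (h1 : ∀ z, g (z + 1) = g z) (w : ℂ) :
    ∫ x in (0 : ℝ)..1, g (x + w) = ∫ x in (0 : ℝ)..1, g x := by
  obtain ⟨G, hG⟩ : ∃ G : ℂ → ℂ, ∀ z, HasDerivAt G (g z) z := by
    obtain ⟨G, hG⟩ := hg.isExactOn_univ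
    exact ⟨G, fun z => hG z trivial⟩
  have hint : ∀ w : ℂ, ∫ x in (0 : ℝ)..1, g (x + w) = G (1 + w) - G w := fun w => by
    have := intervalIntegral.integral_eq_sub_of_hasDerivAt (a := 0) (b := 1)
      (f := fun x : ℝ => G (x + w)) (f' := fun x : ℝ => g (x + w))
      (fun x _ => ((hG (x + w)).comp_add_const (x : ℂ) w).comp_ofReal)
      ((hg.continuous.comp (by fun_prop)).intervalIntegrable _ _)
    simpa using this
  have hconst : ∀ w, HasDerivAt (fun w => G (1 + w) - G w) 0 w := fun w => by
    have := ((hG (1 + w)).comp_const_add 1 w).sub (hG w)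
    rwa [add_comm, h1, sub_self] at this
  have := is_const_of_deriv_eq_zero (fun w => (hconst w).differentiableAt)
    (fun w => (hconst w).deriv) w 0
  rw [hint w, this, ← hint 0]
  simp

/-- Moving the line of integration by τ gives a(r + 2) = e((r + 1)τ) a(r) for the Fourier
coefficients, so a(0) and a(1) determine all of them and are the two coordinates. -/
theorem exists_eq_theta {τ : ℂ} (hτ : 0 < τ.im) {f : ℂ → ℂ} (hf : Differentiable ℂ f)
    (h1 : ∀ z, f (z + 1) = f z)
    (h2 : ∀ z, f (z + τ) = Complex.exp (2 * π * Complex.I * (-τ - 2 * z)) * f z) :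
    ∃ u v : ℂ, ∀ z, f z = u * theta 0 0 z τ + v * theta 1 0 z τ := by
  let a : ℤ → ℂ := fun r =>
    ∫ x in (0 : ℝ)..1, Complex.exp (2 * π * Complex.I * (-(r * x))) * f x
  have hrec : ∀ r, a (r + 2) = Complex.exp (2 * π * Complex.I * ((r + 1) * τ)) * a r := by
    intro r
    have hg : Differentiable ℂ
        (fun z : ℂ => Complex.exp (2 * π * Complex.I * (-(r * z))) * f z) := by fun_prop
    have hp : ∀ z : ℂ, Complex.exp (2 * π * Complex.I * (-(r * (z + 1)))) * f (z + 1) =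
        Complex.exp (2 * π * Complex.I * (-(r * z))) * f z := fun z => by
      rw [h1]
      congr 1
      rw [Complex.exp_eq_exp_iff_exists_int]
      exact ⟨-r, by push_cast; ring⟩
    have := integral_add_eq_of_periodic hg hp τ
    simp only [a]
    rw [← this, ← intervalIntegral.integral_const_mul]
    refine intervalIntegral.integral_congr fun x _ => ?_
    simp only [h2]
    rw [← mul_assoc, ← mul_assoc, ← Complex.exp_add, ← Complex.exp_add]
    congr 2
    push_cast
    ring
  have hcoef : ∀ (ε : ℕ) (n : ℤ), a (2 * n + ε) =
      Complex.exp (2 * π * Complex.I * (((n : ℂ) ^ 2 + ε * n) * τ)) * a ε := by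
    intro ε n
    induction n using Int.induction_on with
    | zero => simp
    | succ n ih =>
      rw [show (2 * ((n : ℤ) + 1) + ε : ℤ) = (2 * n + ε) + 2 by ring, hrec, ih, ← mul_assoc,
        ← Complex.exp_add]
      congr 2
      push_cast
      ring
    | pred n ih =>
      have := hrec (2 * (-n - 1) + ε)
      rw [show (2 * (-(n : ℤ) - 1) + ε + 2 : ℤ) = 2 * (-n) + ε by ring, ih] at this
      rw [← mul_right_inj' (Complex.exp_ne_zero _), ← this,
        ← mul_assoc (Complex.exp _) (Complex.exp _) (a ε), ← Complex.exp_add]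
      congr 2
      push_cast
      ring
  -- Fourier inversion is done on the real line, where f descends to the circle; the identity
  -- theorem then extends the formula to ℂ.
  have hper : Function.Periodic (fun x : ℝ => f x) 1 := fun x => by
    simpa using h1 x
  let F : C(AddCircle (1 : ℝ), ℂ) := ⟨hper.lift, by
    have : Continuous fun x : ℝ => f x := hf.continuous.comp Complex.continuous_ofReal
    exact this.quotient_lift _⟩
  have hFa : ∀ r, fourierCoeff F r = a r := fun r => by
    rw [fourierCoeff_eq_intervalIntegral F r 0]
    simp only [a, zero_add, one_div, inv_one, one_smul]
    refine intervalIntegral.integral_congr fun x _ => ?_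
    simp only [smul_eq_mul]
    rw [fourier_coe_apply]
    congr 1
    congr 1
    push_cast
    ring
  have hsum : ∀ (z : ℂ) (ε : ℕ), ε ≤ 1 → HasSum (fun n : ℤ => a (2 * n + ε) *
      Complex.exp (2 * π * Complex.I * ((2 * n + ε) * z))) (a ε * theta ε 0 z τ) :=
    fun z ε hε => by
      refine ((summable_thetaTerm hε 0 z hτ).hasSum.mul_left (a ε)).congr_fun fun n => ?_
      rw [hcoef, thetaTerm, mul_add (2 * π * Complex.I), Complex.exp_add]
      ring
  have hall : ∀ z : ℂ, HasSum (fun r : ℤ => a r * Complex.exp (2 * π * Complex.I * (r * z)))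
      (a 0 * theta 0 0 z τ + a 1 * theta 1 0 z τ) := fun z => by
    refine hasSum_int_even_add_odd ?_ ?_
    · simpa using hsum z 0 zero_le_one
    · simpa using hsum z 1 le_rfl
  have hreal : ∀ x : ℝ, f x = a 0 * theta 0 0 x τ + a 1 * theta 1 0 x τ := fun x => by
    have hs : Summable (fourierCoeff F) := by
      have := (hall 0).summable
      simpa [hFa, funext hFa] using this
    have := has_pointwise_sum_fourier_series_of_summable hs (x : AddCircle (1 : ℝ))
    have hx : F (x : AddCircle (1 : ℝ)) = f x := rfl
    rw [hx] at this
    refine this.unique ((hall x).congr_fun fun r => ?_)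
    rw [hFa, fourier_coe_apply, smul_eq_mul]
    congr 2
    push_cast
    ring
  refine ⟨a 0, a 1, fun z => ?_⟩
  have hθ : ∀ ε ≤ 1, Differentiable ℂ (fun z => theta ε 0 z τ) := fun ε hε z =>
    (hasDerivAt_theta hε 0 z hτ).differentiableAt
  have hR : Differentiable ℂ (fun z => a 0 * theta 0 0 z τ + a 1 * theta 1 0 z τ) :=
    ((hθ 0 zero_le_one).const_mul _).add ((hθ 1 le_rfl).const_mul _)
  refine congrFun (AnalyticOnNhd.eq_of_frequently_eq (z₀ := 0)
    (fun z _ => hf.analyticAt z) (fun z _ => hR.analyticAt z) ?_) z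
  have ht : Tendsto (fun x : ℝ => (x : ℂ)) (𝓝[≠] 0) (𝓝[≠] 0) := by
    refine tendsto_nhdsWithin_of_tendsto_nhds_of_eventually_within _ ?_ ?_
    · exact (Complex.continuous_ofReal.tendsto' 0 0 (by simp)).mono_left nhdsWithin_le_nhds
    · filter_upwards [self_mem_nhdsWithin] with x hx
      simpa using hx
  exact ht.frequently (Eventually.of_forall hreal).frequently

/-! ### Jacobi-Eisenstein series: convergence -/

/-- The theta term `e(l² γτ + 2 l z / (c τ + d) - c z² / (c τ + d))` for `γ = (a, b; c, d)`. -/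
def slashTerm (a b c d l : ℤ) (z τ : ℂ) : ℂ :=
  Complex.exp (2 * π * Complex.I * ((l : ℂ) ^ 2 * ((a * τ + b) / (c * τ + d)) +
    2 * l * z / (c * τ + d) - c * z ^ 2 / (c * τ + d)))

/-- Coprime pairs of integers. -/
abbrev CoprimePair : Type := {v : Fin 2 → ℤ // IsCoprime (v 0) (v 1)}

/-- The general term of the double series defining `jacobiEisenstein`. -/
def eisSummand (k : ℕ) (z τ : ℂ) (x : CoprimePair × ℤ) : ℂ :=
  ((x.1.1 0 : ℂ) * τ + x.1.1 1) ^ (-(k : ℤ)) *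
    slashTerm (Int.gcdB (x.1.1 0) (x.1.1 1)) (-Int.gcdA (x.1.1 0) (x.1.1 1)) (x.1.1 0) (x.1.1 1)
      x.2 z τ

theorem CoprimePair.bezout (v : CoprimePair) :
    Int.gcdB (v.1 0) (v.1 1) * v.1 1 - (-Int.gcdA (v.1 0) (v.1 1)) * v.1 0 = 1 := by
  have h := Int.gcd_eq_gcd_ab (v.1 0) (v.1 1)
  rw [Int.isCoprime_iff_gcd_eq_one.1 v.2] at h
  push_cast at h
  linarith

theorem CoprimePair.ne_zero (v : CoprimePair) : v.1 ≠ 0 := fun h => by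
  have := v.2
  rw [h] at this
  exact not_isCoprime_zero_zero this

theorem CoprimePair.one_le_norm (v : CoprimePair) : 1 ≤ ‖v.1‖ := by
  have h := v.ne_zero
  rw [EisensteinSeries.norm_eq_max_natAbs]
  have : max (v.1 0).natAbs (v.1 1).natAbs ≠ 0 := fun h0 => h <| by
    ext i
    fin_cases i <;> simp <;> omega
  exact_mod_cast Nat.one_le_iff_ne_zero.2 this

theorem denom_ne_zero_of_det {a b c d : ℤ} (h : a * d - b * c = 1) {τ : ℂ} (hτ : 0 < τ.im) :
    (c * τ + d : ℂ) ≠ 0 := fun h0 => by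
  have him := congrArg Complex.im h0
  have hre := congrArg Complex.re h0
  simp at him hre
  rcases him with hc | hc
  · simp [hc] at hre
    simp [hc, hre] at h
  · exact hτ.ne' hc

/-- Im γτ = Im τ / |cτ + d|² provides Gaussian decay in l. Half of it absorbs the term linear in l
by the inequality of arithmetic and geometric means, and |c| Im τ ≤ |cτ + d| bounds the term in z²
uniformly in (c, d). -/
theorem norm_slashTerm_le {a b c d : ℤ} (h : a * d - b * c = 1) (l : ℤ) (z : ℂ) {τ : ℂ}
    (hτ : 0 < τ.im) :
    ‖slashTerm a b c d l z τ‖ ≤ Real.exp (6 * π * ‖z‖ ^ 2 / τ.im) *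
      Real.exp (-(π * τ.im * l ^ 2 / ‖(c * τ + d : ℂ)‖ ^ 2)) := by
  have hj := denom_ne_zero_of_det h hτ
  set j : ℂ := c * τ + d with hj'
  have hJ : 0 < ‖j‖ := norm_pos_iff.2 hj
  have hT : ((a * τ + b) / j).im = τ.im / ‖j‖ ^ 2 := by
    rw [Complex.div_im, Complex.normSq_eq_norm_sq, ← sub_div]
    congr 1
    have h' : (a * d - b * c : ℝ) = 1 := by exact_mod_cast h
    simp [hj']
    linear_combination τ.im * h'
  have h1 : |(2 * l * z / j).im| ≤ 2 * |(l : ℝ)| * ‖z‖ / ‖j‖ := by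
    refine (Complex.abs_im_le_norm _).trans (le_of_eq ?_)
    simp
  have hc : |(c : ℝ)| * τ.im ≤ ‖j‖ := by
    refine le_trans (le_of_eq ?_) (Complex.abs_im_le_norm _)
    simp [hj', abs_mul, abs_of_pos hτ]
  have h2 : |(c * z ^ 2 / j).im| ≤ ‖z‖ ^ 2 / τ.im := by
    refine (Complex.abs_im_le_norm _).trans ?_
    rw [norm_div, norm_mul, norm_pow, div_le_div_iff₀ hJ hτ]
    have : ‖(c : ℂ)‖ = |(c : ℝ)| := by simp
    rw [this]
    nlinarith [sq_nonneg ‖z‖]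
  have h3 : 2 * |(l : ℝ)| * ‖z‖ / ‖j‖ ≤
      τ.im * l ^ 2 / (2 * ‖j‖ ^ 2) + 2 * ‖z‖ ^ 2 / τ.im := by
    rw [← sub_nonneg]
    have : τ.im * l ^ 2 / (2 * ‖j‖ ^ 2) + 2 * ‖z‖ ^ 2 / τ.im - 2 * |(l : ℝ)| * ‖z‖ / ‖j‖ =
        (τ.im * |(l : ℝ)| - 2 * ‖z‖ * ‖j‖) ^ 2 / (2 * τ.im * ‖j‖ ^ 2) := by
      rw [← sq_abs (l : ℝ)]
      field_simp
      ring
    rw [this]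
    positivity
  have him : τ.im * l ^ 2 / (2 * ‖j‖ ^ 2) - 3 * ‖z‖ ^ 2 / τ.im ≤
      ((l : ℂ) ^ 2 * ((a * τ + b) / j) + 2 * l * z / j - c * z ^ 2 / j).im := by
    have e : ((l : ℂ) ^ 2 * ((a * τ + b) / j) + 2 * l * z / j - c * z ^ 2 / j).im =
        l ^ 2 * (τ.im / ‖j‖ ^ 2) + (2 * l * z / j).im - (c * z ^ 2 / j).im := by
      rw [Complex.sub_im, Complex.add_im, ← hT]
      congr 2
      rw [show ((l : ℂ) ^ 2) = ((l ^ 2 : ℝ) : ℂ) by push_cast; ring, Complex.im_ofReal_mul]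
    rw [e]
    have e1 : (l : ℝ) ^ 2 * (τ.im / ‖j‖ ^ 2) =
        τ.im * l ^ 2 / (2 * ‖j‖ ^ 2) + τ.im * l ^ 2 / (2 * ‖j‖ ^ 2) := by
      field_simp
      ring
    have e2 : 3 * ‖z‖ ^ 2 / τ.im = 2 * ‖z‖ ^ 2 / τ.im + ‖z‖ ^ 2 / τ.im := by ring
    linarith [neg_abs_le (2 * l * z / j).im, le_abs_self (c * z ^ 2 / j).im]
  rw [slashTerm, Complex.norm_exp, ← Real.exp_add, Real.exp_le_exp, ← hj']
  have : ∀ w : ℂ, (2 * π * Complex.I * w).re = -(2 * π * w.im) := fun w => by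
    rw [show 2 * π * Complex.I * w = ((2 * π : ℝ) : ℂ) * w * Complex.I by push_cast; ring,
      Complex.mul_I_re, Complex.im_ofReal_mul]
  rw [this]
  have := mul_le_mul_of_nonneg_left him (by positivity : 0 ≤ 2 * π)
  have e3 : 2 * π * (τ.im * l ^ 2 / (2 * ‖j‖ ^ 2) - 3 * ‖z‖ ^ 2 / τ.im) =
      π * τ.im * l ^ 2 / ‖j‖ ^ 2 - 6 * π * ‖z‖ ^ 2 / τ.im := by
    field_simp
    ring
  linarith

/-- A summable majorant over pairs `(v, l)`. -/
def eisMajorant (x : CoprimePair × ℤ) : ℝ :=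
  ‖x.1.1‖ ^ (-(5 / 2) : ℝ) * (|(x.2 : ℝ)| ^ (-(3 / 2) : ℝ) + if x.2 = 0 then 1 else 0)

/-- The exponents 5/2 > 2 for pairs and 3/2 > 1 for l add up to 4, the smallest weight treated. The
indicator is needed at l = 0, where the real power 0^(-3/2) is 0 by convention. -/
theorem summable_eisMajorant : Summable eisMajorant := by
  have h1 : Summable fun v : CoprimePair => ‖v.1‖ ^ (-(5 / 2) : ℝ) :=
    (EisensteinSeries.summable_one_div_norm_rpow (by norm_num : (2 : ℝ) < 5 / 2)).comp_injective
      Subtype.val_injective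
  have h2 : Summable fun l : ℤ => |(l : ℝ)| ^ (-(3 / 2) : ℝ) + if l = 0 then (1 : ℝ) else 0 :=
    (Real.summable_abs_int_rpow (by norm_num : (1 : ℝ) < 3 / 2)).add
      (summable_of_ne_finset_zero (s := {0}) fun l hl => by simpa using hl)
  exact h1.mul_of_nonneg h2 (fun v => by positivity) (fun l => by positivity)

/-- The exponent 3/4 is chosen so that l² / |cτ + d|² contributes |l|^(-3/2) |cτ + d|^(3/2). -/
theorem exp_neg_le_rpow {x : ℝ} (hx : 0 < x) : Real.exp (-x) ≤ x ^ (-(3 / 4) : ℝ) := by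
  rw [Real.exp_neg, Real.rpow_neg hx.le]
  refine inv_anti₀ (by positivity) ?_
  calc x ^ (3 / 4 : ℝ) ≤ (Real.exp x) ^ (3 / 4 : ℝ) := by
        gcongr
        linarith [Real.add_one_le_exp x]
    _ = Real.exp (x * (3 / 4)) := by rw [← Real.exp_mul]
    _ ≤ Real.exp x := by
        apply Real.exp_le_exp.2
        linarith

theorem zpow_mul_exp_le {k : ℕ} (hk : 4 ≤ k) {ρ B : ℝ} (hρ : 0 < ρ) (hB : 0 < B) {J y N : ℝ}
    (hN : 1 ≤ N) (hJ : ρ * N ≤ J) (hy : B ≤ y) (l : ℤ) :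
    J ^ (-(k : ℤ)) * Real.exp (-(π * y * l ^ 2 / J ^ 2)) ≤
      (ρ ^ (-(k : ℝ)) + (π * B) ^ (-(3 / 4) : ℝ) * ρ ^ (3 / 2 - k : ℝ)) *
        (N ^ (-(5 / 2) : ℝ) * (|(l : ℝ)| ^ (-(3 / 2) : ℝ) + if l = 0 then 1 else 0)) := by
  have hN0 : 0 < N := by linarith
  have hJ0 : 0 < J := lt_of_lt_of_le (by positivity) hJ
  have hy0 : 0 < y := by linarith
  have hk' : (4 : ℝ) ≤ k := by exact_mod_cast hk
  have hz : J ^ (-(k : ℤ)) = J ^ (-(k : ℝ)) := by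
    rw [← Real.rpow_intCast]; push_cast; rfl
  have hNpow : ∀ s : ℝ, s ≤ -(5 / 2) → J ^ s ≤ ρ ^ s * N ^ (-(5 / 2) : ℝ) := fun s hs => by
    calc J ^ s ≤ (ρ * N) ^ s := Real.rpow_le_rpow_of_nonpos (by positivity) hJ (by linarith)
      _ = ρ ^ s * N ^ s := Real.mul_rpow hρ.le hN0.le
      _ ≤ _ := by
        gcongr
  rw [hz]
  rcases eq_or_ne l 0 with rfl | hl
  · have : (|((0 : ℤ) : ℝ)| ^ (-(3 / 2) : ℝ)) = 0 := by
      rw [Int.cast_zero, abs_zero, Real.zero_rpow (by norm_num)]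
    rw [this]
    simp only [Int.cast_zero, ne_eq, OfNat.ofNat_ne_zero, not_false_eq_true, zero_pow, mul_zero,
      zero_div, neg_zero, Real.exp_zero, mul_one, zero_add, if_true]
    refine (hNpow _ (by linarith)).trans ?_
    gcongr
    have : 0 ≤ (π * B) ^ (-(3 / 4) : ℝ) * ρ ^ (3 / 2 - k : ℝ) := by positivity
    linarith
  · have hl0 : 0 < |(l : ℝ)| := abs_pos.2 (by exact_mod_cast hl)
    rw [if_neg hl, add_zero]
    have h1 : Real.exp (-(π * y * l ^ 2 / J ^ 2)) ≤
        (π * B) ^ (-(3 / 4) : ℝ) * |(l : ℝ)| ^ (-(3 / 2) : ℝ) * J ^ (3 / 2 : ℝ) := by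
      rw [← sq_abs (l : ℝ)]
      refine (exp_neg_le_rpow (by positivity)).trans ?_
      have e : (π * y * |(l : ℝ)| ^ 2 / J ^ 2) = (π * y) * (|(l : ℝ)| ^ 2 * (J ^ 2)⁻¹) := by ring
      have e1 : (|(l : ℝ)| ^ 2) ^ (-(3 / 4) : ℝ) = |(l : ℝ)| ^ (-(3 / 2) : ℝ) := by
        rw [← Real.rpow_natCast_mul hl0.le]; norm_num
      have e2 : ((J ^ 2)⁻¹) ^ (-(3 / 4) : ℝ) = J ^ (3 / 2 : ℝ) := by
        rw [Real.inv_rpow (by positivity), ← Real.rpow_neg (by positivity),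
          ← Real.rpow_natCast_mul hJ0.le]
        norm_num
      have hA : (0 : ℝ) ≤ |(l : ℝ)| ^ 2 * (J ^ 2)⁻¹ := by positivity
      have hB' : (0 : ℝ) ≤ π * y := by positivity
      rw [e, Real.mul_rpow hB' hA, Real.mul_rpow (sq_nonneg |(l : ℝ)|) (by positivity), e1, e2,
        ← mul_assoc]
      gcongr ?_ * _ * _
      exact Real.rpow_le_rpow_of_nonpos (by positivity) (by gcongr) (by norm_num)
    calc J ^ (-(k : ℝ)) * Real.exp (-(π * y * l ^ 2 / J ^ 2))
        ≤ J ^ (-(k : ℝ)) *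
          ((π * B) ^ (-(3 / 4) : ℝ) * |(l : ℝ)| ^ (-(3 / 2) : ℝ) * J ^ (3 / 2 : ℝ)) := by gcongr
      _ = (π * B) ^ (-(3 / 4) : ℝ) * |(l : ℝ)| ^ (-(3 / 2) : ℝ) * J ^ (3 / 2 - k : ℝ) := by
        rw [sub_eq_add_neg, Real.rpow_add hJ0]; ring
      _ ≤ (π * B) ^ (-(3 / 4) : ℝ) * |(l : ℝ)| ^ (-(3 / 2) : ℝ) *
          (ρ ^ (3 / 2 - k : ℝ) * N ^ (-(5 / 2) : ℝ)) := by
        gcongr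
        exact hNpow _ (by linarith)
      _ = ((π * B) ^ (-(3 / 4) : ℝ) * ρ ^ (3 / 2 - k : ℝ)) *
          (N ^ (-(5 / 2) : ℝ) * |(l : ℝ)| ^ (-(3 / 2) : ℝ)) := by ring
      _ ≤ _ := by
        gcongr
        have : 0 ≤ ρ ^ (-(k : ℝ)) := by positivity
        linarith

theorem norm_eisSummand_le (k : ℕ) (z : ℂ) (τ : ℍ) (x : CoprimePair × ℤ) :
    ‖eisSummand k z τ x‖ ≤ ‖((x.1.1 0 : ℂ) * τ + x.1.1 1)‖ ^ (-(k : ℤ)) *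
      (Real.exp (6 * π * ‖z‖ ^ 2 / τ.im) * Real.exp (-(π * τ.im * x.2 ^ 2 /
        ‖((x.1.1 0 : ℂ) * τ + x.1.1 1)‖ ^ 2))) := by
  rw [eisSummand, norm_mul, norm_zpow]
  gcongr
  exact norm_slashTerm_le x.1.bezout x.2 z τ.im_pos

/-- `EisensteinSeries.r` bounds |cτ + d| below by a multiple of ‖(c, d)‖ throughout a vertical
half-strip. The uniform constant yields summability, holomorphy in z and in τ, and the limit at the
cusp. -/
theorem exists_norm_eisSummand_le {k : ℕ} (hk : 4 ≤ k) (R A : ℝ) {B : ℝ} (hB : 0 < B) :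
    ∃ C : ℝ, ∀ (z : ℂ) (τ : ℍ), ‖z‖ ≤ R → |τ.re| ≤ A → B ≤ τ.im →
      ∀ x, ‖eisSummand k z τ x‖ ≤ C * eisMajorant x := by
  have hρ := EisensteinSeries.r_pos ⟨⟨A, B⟩, hB⟩
  set ρ := EisensteinSeries.r ⟨⟨A, B⟩, hB⟩ with hρ'
  refine ⟨Real.exp (6 * π * R ^ 2 / B) *
    (ρ ^ (-(k : ℝ)) + (π * B) ^ (-(3 / 4) : ℝ) * ρ ^ (3 / 2 - k : ℝ)),
    fun z τ hz hA hτ x => ?_⟩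
  have hJ : ρ * ‖x.1.1‖ ≤ ‖((x.1.1 0 : ℂ) * τ + x.1.1 1)‖ := by
    refine le_trans ?_ (EisensteinSeries.r_mul_max_le τ x.1.ne_zero)
    gcongr
    exact EisensteinSeries.r_lower_bound_on_verticalStrip τ hB ⟨hA, hτ⟩
  have h1 := zpow_mul_exp_le hk hρ hB x.1.one_le_norm hJ hτ x.2
  refine (norm_eisSummand_le k z τ x).trans ?_
  have h2 : Real.exp (6 * π * ‖z‖ ^ 2 / τ.im) ≤ Real.exp (6 * π * R ^ 2 / B) := by
    apply Real.exp_le_exp.2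
    gcongr
  calc _ = Real.exp (6 * π * ‖z‖ ^ 2 / τ.im) *
        (‖((x.1.1 0 : ℂ) * τ + x.1.1 1)‖ ^ (-(k : ℤ)) * Real.exp (-(π * τ.im * x.2 ^ 2 /
        ‖((x.1.1 0 : ℂ) * τ + x.1.1 1)‖ ^ 2))) := by ring
    _ ≤ Real.exp (6 * π * R ^ 2 / B) * _ := mul_le_mul h2 h1 (by positivity) (by positivity)
    _ = _ := by rw [eisMajorant]; ring

theorem summable_eisSummand {k : ℕ} (hk : 4 ≤ k) (z : ℂ) (τ : ℍ) :
    Summable (eisSummand k z τ) := by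
  obtain ⟨C, hC⟩ := exists_norm_eisSummand_le hk ‖z‖ |τ.re| τ.im_pos
  exact (summable_eisMajorant.mul_left C).of_norm_bounded
    (fun x => hC z τ le_rfl le_rfl le_rfl x)

theorem jacobiEisenstein_eq_tsum {k : ℕ} (hk : 4 ≤ k) (z : ℂ) (τ : ℍ) :
    jacobiEisenstein k z τ = 1 / 2 * ∑' x, eisSummand k z τ x := by
  rw [(summable_eisSummand hk z τ).tsum_prod, jacobiEisenstein]
  congr 1
  refine tsum_congr fun v => ?_
  simp only [eisSummand]
  rw [tsum_mul_left]
  congr 1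
  refine tsum_congr fun l => ?_
  rw [slashTerm]
  push_cast
  ring_nf

theorem differentiable_jacobiEisenstein {k : ℕ} (hk : 4 ≤ k) (τ : ℍ) :
    Differentiable ℂ (fun z => jacobiEisenstein k z τ) := by
  intro z
  simp only [jacobiEisenstein_eq_tsum hk]
  obtain ⟨C, hC⟩ := exists_norm_eisSummand_le hk (‖z‖ + 1) |τ.re| τ.im_pos
  have hU : IsOpen {w : ℂ | ‖w‖ < ‖z‖ + 1} := isOpen_lt (by fun_prop) continuous_const
  refine DifferentiableAt.const_mul ((Complex.differentiableOn_tsum_of_summable_norm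
    (summable_eisMajorant.mul_left C) (fun x => ?_) hU
    (fun x w hw => hC w τ (le_of_lt hw) le_rfl le_rfl x)).differentiableAt
    (hU.mem_nhds (by simp))) _
  unfold eisSummand slashTerm
  fun_prop

theorem mdifferentiable_jacobiEisenstein {k : ℕ} (hk : 4 ≤ k) (z : ℂ) :
    MDiff (fun τ => jacobiEisenstein k z τ) := by
  rw [UpperHalfPlane.mdifferentiable_iff]
  simp only [jacobiEisenstein_eq_tsum hk]
  suffices h : DifferentiableOn ℂ (fun t : ℂ => 1 / 2 * ∑' x, eisSummand k z t x)
      {t | 0 < t.im} by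
    refine h.congr fun t ht => ?_
    simp [UpperHalfPlane.ofComplex_apply_of_im_pos ht]
  intro t ht
  have ht' : 0 < t.im := ht
  obtain ⟨C, hC⟩ := exists_norm_eisSummand_le hk ‖z‖ (|t.re| + 1) (half_pos ht')
  have hU : IsOpen {w : ℂ | |w.re| < |t.re| + 1 ∧ t.im / 2 < w.im} :=
    IsOpen.inter (s := {w : ℂ | |w.re| < |t.re| + 1}) (t := {w : ℂ | t.im / 2 < w.im})
      (isOpen_lt (by fun_prop) continuous_const) (isOpen_lt continuous_const (by fun_prop))
  refine (DifferentiableAt.const_mul ((Complex.differentiableOn_tsum_of_summable_norm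
    (summable_eisMajorant.mul_left C) (fun x => ?_) hU
    (fun x w hw => hC z ⟨w, (half_pos ht').trans hw.2⟩ le_rfl hw.1.le hw.2.le x)).differentiableAt
    (hU.mem_nhds ⟨by simp, by simpa using ht'⟩)) _).differentiableWithinAt
  intro w hw
  have h0 := denom_ne_zero_of_det x.1.bezout ((half_pos ht').trans hw.2)
  refine DifferentiableAt.differentiableWithinAt ?_
  unfold eisSummand slashTerm
  refine DifferentiableAt.mul (DifferentiableAt.zpow (by fun_prop) (Or.inl h0)) ?_
  fun_prop (disch := exact h0)

/-! ### Jacobi-Eisenstein series: transformation laws -/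

/-- Another choice of (a, b) changes γτ by an integer. This allows the Bezout coefficients to be
exchanged for convenient ones after (c, d) has been moved by S or T. -/
theorem slashTerm_congr {a b a' b' c d : ℤ} (h : a * d - b * c = 1) (h' : a' * d - b' * c = 1)
    (l : ℤ) (z : ℂ) {τ : ℂ} (hτ : 0 < τ.im) :
    slashTerm a b c d l z τ = slashTerm a' b' c d l z τ := by
  have hj := denom_ne_zero_of_det h hτ
  have e : (a * τ + b : ℂ) / (c * τ + d) = (a' * τ + b') / (c * τ + d) - (a * b' - a' * b : ℤ) := by
    have h1 : (a * d - b * c : ℂ) = 1 := by exact_mod_cast h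
    have h2 : (a' * d - b' * c : ℂ) = 1 := by exact_mod_cast h'
    rw [div_eq_iff hj, sub_mul, div_mul_cancel₀ _ hj]
    push_cast
    linear_combination (a' * τ + b' : ℂ) * h1 - (a * τ + b : ℂ) * h2
  rw [slashTerm, slashTerm, e, Complex.exp_eq_exp_iff_exists_int]
  exact ⟨-(l ^ 2 * (a * b' - a' * b)), by push_cast; ring⟩

/-- By 1 / (cτ + d) = a - c γτ, adding 1 to z is the shift of l by -c, up to an integer in the
exponent. -/
theorem slashTerm_add_one {a b c d : ℤ} (h : a * d - b * c = 1) (l : ℤ) (z : ℂ) {τ : ℂ}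
    (hτ : 0 < τ.im) : slashTerm a b c d l (z + 1) τ = slashTerm a b c d (l - c) z τ := by
  have hj := denom_ne_zero_of_det h hτ
  have h1 : (a * d - b * c : ℂ) = 1 := by exact_mod_cast h
  have e : (c * τ + d : ℂ)⁻¹ = a - c * ((a * τ + b) / (c * τ + d)) := by
    field_simp
    linear_combination -h1
  rw [slashTerm, slashTerm, Complex.exp_eq_exp_iff_exists_int]
  refine ⟨(2 * l - c) * a, ?_⟩
  set T : ℂ := (a * τ + b) / (c * τ + d)
  simp only [div_eq_mul_inv, Int.cast_sub, Int.cast_mul, Int.cast_ofNat]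
  rw [e]
  ring

/-- By τ / (cτ + d) = d γτ - b, adding τ to z is the shift of l by d, up to the quasi-period factor.
-/
theorem slashTerm_add_tau {a b c d : ℤ} (h : a * d - b * c = 1) (l : ℤ) (z : ℂ) {τ : ℂ}
    (hτ : 0 < τ.im) : slashTerm a b c d l (z + τ) τ =
      Complex.exp (2 * π * Complex.I * (-τ - 2 * z)) * slashTerm a b c d (l + d) z τ := by
  have hj := denom_ne_zero_of_det h hτ
  have h1 : (a * d - b * c : ℂ) = 1 := by exact_mod_cast h
  set J : ℂ := (c * τ + d)⁻¹ with hJ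
  set T : ℂ := (a * τ + b) * J with hT
  have hJj : (c * τ + d : ℂ) * J = 1 := mul_inv_cancel₀ hj
  have e1 : τ * J = d * T - b := by
    rw [hT]
    linear_combination (-τ * J) * h1 - b * hJj
  have e2 : c * (τ * J) = 1 - d * J := by
    linear_combination hJj
  rw [slashTerm, slashTerm, ← Complex.exp_add, Complex.exp_eq_exp_iff_exists_int]
  refine ⟨-(2 * l * b) - d * b, ?_⟩
  simp only [div_eq_mul_inv, ← hJ, ← hT, Int.cast_add, Int.cast_sub, Int.cast_neg, Int.cast_mul,
    Int.cast_ofNat]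
  linear_combination (2 * π * Complex.I) * ((2 * l + d : ℂ) * e1 - (2 * z + τ) * e2)

/-- The matrix product (a, b; c, d) S is (b, -a; d, -c). -/
theorem slashTerm_S {a b c d : ℤ} (h : a * d - b * c = 1) (l : ℤ) (z : ℂ) {τ : ℂ}
    (hτ : 0 < τ.im) : slashTerm a b c d l (z / τ) (-1 / τ) =
      Complex.exp (2 * π * Complex.I * (z ^ 2 / τ)) * slashTerm b (-a) d (-c) l z τ := by
  have hτ0 : τ ≠ 0 := fun h0 => by simp [h0] at hτ
  have hj : (d * τ + (-c : ℤ) : ℂ) ≠ 0 :=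
    denom_ne_zero_of_det (a := b) (b := -a) (by linarith) hτ
  have hj' : (c * (-1 / τ) + d : ℂ) = (d * τ + (-c : ℤ)) / τ := by
    field_simp
    push_cast
    ring
  rw [slashTerm, slashTerm, ← Complex.exp_add, hj']
  congr 1
  push_cast at hj ⊢
  set K : ℂ := (d * τ + -c : ℂ)⁻¹ with hKdef
  have hK : (d * τ + -c : ℂ) * K = 1 := mul_inv_cancel₀ hj
  have ht : τ * τ⁻¹ = 1 := mul_inv_cancel₀ hτ0
  simp only [div_eq_mul_inv, mul_inv, inv_inv, ← hKdef]
  linear_combination (2 * π * Complex.I) * ((-l ^ 2 * a * K + 2 * l * z * K -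
    c * z ^ 2 * τ⁻¹ * K - z ^ 2 * d * K) * ht + z ^ 2 * τ⁻¹ * hK)

/-- The contribution of one coprime pair to the Jacobi-Eisenstein series. -/
def eisInner (k : ℕ) (z τ : ℂ) (v : CoprimePair) : ℂ :=
  ((v.1 0 : ℂ) * τ + v.1 1) ^ (-(k : ℤ)) *
    ∑' l : ℤ, slashTerm (Int.gcdB (v.1 0) (v.1 1)) (-Int.gcdA (v.1 0) (v.1 1)) (v.1 0) (v.1 1)
      l z τ

theorem jacobiEisenstein_eq_tsum_eisInner (k : ℕ) (z : ℂ) (τ : ℍ) :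
    jacobiEisenstein k z τ = 1 / 2 * ∑' v, eisInner k z τ v := by
  rw [jacobiEisenstein]
  congr 1
  refine tsum_congr fun v => ?_
  rw [eisInner]
  congr 1
  refine tsum_congr fun l => ?_
  rw [slashTerm]
  push_cast
  ring_nf

theorem eisInner_eq (k : ℕ) (z : ℂ) {τ : ℂ} (hτ : 0 < τ.im) (v : CoprimePair) {a b : ℤ}
    (h : a * v.1 1 - b * v.1 0 = 1) :
    eisInner k z τ v = ((v.1 0 : ℂ) * τ + v.1 1) ^ (-(k : ℤ)) *
      ∑' l : ℤ, slashTerm a b (v.1 0) (v.1 1) l z τ := by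
  rw [eisInner]
  congr 1
  exact tsum_congr fun l => slashTerm_congr v.bezout h l z hτ

theorem jacobiEisenstein_add_one (k : ℕ) (z : ℂ) (τ : ℍ) :
    jacobiEisenstein k (z + 1) τ = jacobiEisenstein k z τ := by
  rw [jacobiEisenstein_eq_tsum_eisInner, jacobiEisenstein_eq_tsum_eisInner]
  congr 1
  refine tsum_congr fun v => ?_
  rw [eisInner, eisInner]
  congr 1
  simp only [slashTerm_add_one v.bezout _ z τ.im_pos]
  exact (Equiv.subRight (v.1 0)).tsum_eq (fun l => slashTerm (Int.gcdB (v.1 0) (v.1 1)) (-Int.gcdA (v.1 0) (v.1 1))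
    (v.1 0) (v.1 1) l z τ)

theorem jacobiEisenstein_add_tau (k : ℕ) (z : ℂ) (τ : ℍ) :
    jacobiEisenstein k (z + τ) τ =
      Complex.exp (2 * π * Complex.I * (-τ - 2 * z)) * jacobiEisenstein k z τ := by
  rw [jacobiEisenstein_eq_tsum_eisInner, jacobiEisenstein_eq_tsum_eisInner, mul_left_comm]
  congr 1
  rw [← tsum_mul_left]
  refine tsum_congr fun v => ?_
  rw [eisInner, eisInner, mul_left_comm]
  congr 1
  rw [← tsum_mul_left]
  simp only [slashTerm_add_tau v.bezout _ z τ.im_pos]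
  exact (Equiv.addRight (v.1 1)).tsum_eq
    (fun l => Complex.exp (2 * π * Complex.I * (-τ - 2 * z)) *
      slashTerm (Int.gcdB (v.1 0) (v.1 1)) (-Int.gcdA (v.1 0) (v.1 1))
    (v.1 0) (v.1 1) l z τ)

/-- The action of `S` on coprime pairs, `(c, d) ↦ (d, -c)`. -/
def CoprimePair.rotate : CoprimePair ≃ CoprimePair where
  toFun v := ⟨![v.1 1, -v.1 0], by simpa using v.2.symm.neg_right⟩
  invFun v := ⟨![-v.1 1, v.1 0], by simpa using v.2.symm.neg_left⟩
  left_inv v := by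
    ext i
    fin_cases i <;> simp
  right_inv v := by
    ext i
    fin_cases i <;> simp

/-- The action of `T` on coprime pairs, `(c, d) ↦ (c, c + d)`. -/
def CoprimePair.shear : CoprimePair ≃ CoprimePair where
  toFun v := ⟨![v.1 0, v.1 0 + v.1 1], by
    have := v.2.add_mul_left_right 1
    rw [mul_one, add_comm] at this
    simpa using this⟩
  invFun v := ⟨![v.1 0, v.1 1 - v.1 0], by
    have := v.2.add_mul_left_right (-1)
    rw [mul_neg_one, ← sub_eq_add_neg] at this
    simpa using this⟩
  left_inv v := by
    ext i
    fin_cases i <;> simp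
  right_inv v := by
    ext i
    fin_cases i <;> simp

theorem coe_S_smul (τ : ℍ) : ((ModularGroup.S • τ : ℍ) : ℂ) = -1 / τ := by
  rw [UpperHalfPlane.modular_S_smul, UpperHalfPlane.coe_mk, inv_neg, neg_div, one_div]

/-- S permutes the coprime bottom rows. Reindexing along a bijection and extracting a constant
factor need no convergence, so there is no condition on k. -/
theorem jacobiEisenstein_S (k : ℕ) (z : ℂ) (τ : ℍ) :
    jacobiEisenstein k (z / τ) (ModularGroup.S • τ) =
      (τ : ℂ) ^ k * Complex.exp (2 * π * Complex.I * (z ^ 2 / τ)) * jacobiEisenstein k z τ := by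
  rw [jacobiEisenstein_eq_tsum_eisInner, jacobiEisenstein_eq_tsum_eisInner, mul_left_comm]
  congr 1
  rw [← CoprimePair.rotate.tsum_eq (eisInner k z τ), ← tsum_mul_left]
  refine tsum_congr fun v => ?_
  have hdet : -Int.gcdA (v.1 0) (v.1 1) * (CoprimePair.rotate v).1 1 -
      -Int.gcdB (v.1 0) (v.1 1) * (CoprimePair.rotate v).1 0 = 1 := by
    have := v.bezout
    simp only [CoprimePair.rotate, Equiv.coe_fn_mk, Matrix.cons_val_zero, Matrix.cons_val_one]
    linarith
  rw [eisInner_eq k z τ.im_pos (CoprimePair.rotate v) hdet, eisInner, coe_S_smul]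
  simp only [slashTerm_S v.bezout _ z τ.im_pos]
  rw [tsum_mul_left]
  have hτ := τ.ne_zero
  have hj : ((v.1 0 : ℂ) * (-1 / τ) + v.1 1) = ((v.1 1 : ℂ) * τ + (-v.1 0 : ℤ)) / τ := by
    field_simp
    push_cast
    ring
  rw [hj, div_zpow, zpow_neg (τ : ℂ), zpow_natCast]
  simp only [CoprimePair.rotate, Equiv.coe_fn_mk, Matrix.cons_val_zero, Matrix.cons_val_one]
  field_simp

theorem jacobiEisenstein_T (k : ℕ) (z : ℂ) (τ : ℍ) :
    jacobiEisenstein k z (ModularGroup.T • τ) = jacobiEisenstein k z τ := by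
  rw [jacobiEisenstein_eq_tsum_eisInner, jacobiEisenstein_eq_tsum_eisInner,
    ← CoprimePair.shear.tsum_eq (eisInner k z τ)]
  congr 1
  refine tsum_congr fun v => ?_
  have hdet : Int.gcdB (v.1 0) (v.1 1) * (CoprimePair.shear v).1 1 -
      (Int.gcdB (v.1 0) (v.1 1) + -Int.gcdA (v.1 0) (v.1 1)) * (CoprimePair.shear v).1 0 = 1 := by
    have := v.bezout
    simp only [CoprimePair.shear, Equiv.coe_fn_mk, Matrix.cons_val_zero, Matrix.cons_val_one]
    linarith
  rw [eisInner_eq k z τ.im_pos (CoprimePair.shear v) hdet, eisInner,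
    UpperHalfPlane.modular_T_smul, UpperHalfPlane.coe_vadd]
  simp only [CoprimePair.shear, Equiv.coe_fn_mk, Matrix.cons_val_zero, Matrix.cons_val_one]
  congr 1
  · congr 1
    push_cast
    ring
  · refine tsum_congr fun l => ?_
    rw [slashTerm, slashTerm]
    congr 1
    push_cast
    ring

/-! ### Behaviour at the cusp -/

theorem exists_T_zpow_smul_re (τ : ℍ) : ∃ n : ℤ, |(ModularGroup.T ^ n • τ).re| ≤ 1 := by
  refine ⟨-⌊τ.re⌋, ?_⟩
  rw [ModularGroup.re_T_zpow_smul, abs_le]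
  have h1 := Int.floor_le τ.re
  have h2 := Int.lt_floor_add_one τ.re
  push_cast
  constructor <;> linarith

theorem apply_T_zpow_smul {f : ℍ → ℂ} (hf : ∀ τ, f (ModularGroup.T • τ) = f τ) (n : ℤ) (τ : ℍ) :
    f (ModularGroup.T ^ n • τ) = f τ := by
  induction n using Int.induction_on with
  | zero => simp
  | succ n ih => rw [add_comm, zpow_add, zpow_one, mul_smul, hf, ih]
  | pred n ih =>
    rw [← ih, ← hf (ModularGroup.T ^ (-(n : ℤ) - 1) • τ), ← mul_smul, ← zpow_one_add]
    congr 3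
    ring

/-- A power of T brings every τ into the strip without changing Im τ. The reduction is needed
because the majorant of the Eisenstein summands is uniform on vertical strips only. -/
theorem tendsto_atImInfty_of_strip {f : ℍ → ℂ} (hf : ∀ τ, f (ModularGroup.T • τ) = f τ) {a : ℂ}
    (h : Tendsto f (UpperHalfPlane.atImInfty ⊓ 𝓟 {τ | |τ.re| ≤ 1}) (𝓝 a)) :
    Tendsto f UpperHalfPlane.atImInfty (𝓝 a) := by
  choose n hn using exists_T_zpow_smul_re
  have h1 : Tendsto (fun τ => ModularGroup.T ^ n τ • τ) UpperHalfPlane.atImInfty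
      (UpperHalfPlane.atImInfty ⊓ 𝓟 {τ | |τ.re| ≤ 1}) := by
    refine tendsto_inf.2 ⟨?_, tendsto_principal.2 (Eventually.of_forall hn)⟩
    rw [UpperHalfPlane.atImInfty, tendsto_comap_iff]
    refine (tendsto_comap (f := UpperHalfPlane.im)).congr fun τ => ?_
    exact (ModularGroup.im_T_zpow_smul τ (n τ)).symm
  exact (h.comp h1).congr fun τ => apply_T_zpow_smul hf _ _

theorem tendsto_im_atImInfty_strip (s : Set ℍ) :
    Tendsto UpperHalfPlane.im (UpperHalfPlane.atImInfty ⊓ 𝓟 s) atTop :=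
  tendsto_comap.mono_left inf_le_left

theorem eisSummand_of_zero {k : ℕ} (hk : Even k) (z τ : ℂ) (v : CoprimePair) (hv : v.1 0 = 0) :
    eisSummand k z τ (v, 0) = 1 := by
  have h1 : v.1 1 = 1 ∨ v.1 1 = -1 := by
    have := v.2
    rw [hv, isCoprime_zero_left] at this
    exact Int.isUnit_iff.1 this
  have h2 : ((v.1 1 : ℂ)) ^ (-(k : ℤ)) = 1 := by
    rw [zpow_neg, zpow_natCast]
    rcases h1 with h | h <;> simp [h, hk.neg_pow]
  rw [eisSummand, slashTerm]
  simp [hv, h2]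

/-- For c = 0 and l ≠ 0 the Gaussian factor tends to 0; for c ≠ 0 the automorphy factor does, since
|cτ + d| ≥ Im τ. -/
theorem tendsto_eisSummand {k : ℕ} (hk : 4 ≤ k) (z : ℂ) (s : Set ℍ) (x : CoprimePair × ℤ)
    (hx : ¬ (x.1.1 0 = 0 ∧ x.2 = 0)) :
    Tendsto (fun τ : ℍ => eisSummand k z τ x) (UpperHalfPlane.atImInfty ⊓ 𝓟 s) (𝓝 0) := by
  have him := tendsto_im_atImInfty_strip s
  have hy : ∀ᶠ τ : ℍ in UpperHalfPlane.atImInfty ⊓ 𝓟 s, 1 ≤ τ.im :=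
    him.eventually (eventually_ge_atTop 1)
  by_cases hc : x.1.1 0 = 0
  · have hl : x.2 ≠ 0 := fun h => hx ⟨hc, h⟩
    have hd : ‖(x.1.1 1 : ℂ)‖ = 1 := by
      have := x.1.2
      rw [hc, isCoprime_zero_left] at this
      rcases Int.isUnit_iff.1 this with h | h <;> simp [h]
    have hlim : Tendsto (fun τ : ℍ => Real.exp (6 * π * ‖z‖ ^ 2) *
        Real.exp (-((π * (x.2 : ℝ) ^ 2) * τ.im))) (UpperHalfPlane.atImInfty ⊓ 𝓟 s) (𝓝 0) := by
      have hl' : (0 : ℝ) < (x.2 : ℝ) ^ 2 := by positivity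
      have := (Real.tendsto_exp_neg_atTop_nhds_zero.comp
        (him.const_mul_atTop (by positivity : 0 < π * (x.2 : ℝ) ^ 2))).const_mul
          (Real.exp (6 * π * ‖z‖ ^ 2))
      rwa [mul_zero] at this
    refine squeeze_zero_norm' ?_ hlim
    filter_upwards [hy] with τ hτ
    refine (norm_eisSummand_le k z τ x).trans ?_
    simp only [hc, Int.cast_zero, zero_mul, zero_add, hd, one_zpow, one_mul, one_pow, div_one]
    refine mul_le_mul (Real.exp_le_exp.2 (div_le_self (by positivity) hτ))
      (Real.exp_le_exp.2 (le_of_eq (by ring))) (by positivity) (by positivity)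
  · have hlim : Tendsto (fun τ : ℍ => τ.im ^ (-(k : ℤ)) * Real.exp (6 * π * ‖z‖ ^ 2))
        (UpperHalfPlane.atImInfty ⊓ 𝓟 s) (𝓝 0) := by
      have := ((tendsto_pow_neg_atTop (𝕜 := ℝ) (by omega : k ≠ 0)).comp him).mul_const
        (Real.exp (6 * π * ‖z‖ ^ 2))
      rw [zero_mul] at this
      exact this
    refine squeeze_zero_norm' ?_ hlim
    filter_upwards [hy] with τ hτ
    refine (norm_eisSummand_le k z τ x).trans ?_
    have hJ : τ.im ≤ ‖((x.1.1 0 : ℂ) * τ + x.1.1 1)‖ := by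
      have h1 : (1 : ℝ) ≤ |(x.1.1 0 : ℝ)| := by exact_mod_cast Int.one_le_abs hc
      calc τ.im ≤ |(x.1.1 0 : ℝ)| * τ.im := le_mul_of_one_le_left τ.im_pos.le h1
        _ = |((x.1.1 0 : ℂ) * τ + x.1.1 1).im| := by simp [abs_mul, abs_of_pos τ.im_pos]
        _ ≤ _ := Complex.abs_im_le_norm _
    gcongr ?_ * ?_
    · rw [zpow_neg, zpow_neg, zpow_natCast, zpow_natCast]
      exact inv_anti₀ (by have := τ.im_pos; positivity) (by gcongr)
    · calc _ ≤ Real.exp (6 * π * ‖z‖ ^ 2) * 1 := by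
            gcongr
            · exact div_le_self (by positivity) hτ
            · rw [Real.exp_le_one_iff, neg_nonpos]
              have := τ.im_pos
              positivity
        _ = _ := mul_one _

theorem tendsto_jacobiEisenstein {k : ℕ} (hk : 4 ≤ k) (hk2 : Even k) (z : ℂ) :
    Tendsto (fun τ => jacobiEisenstein k z τ) UpperHalfPlane.atImInfty (𝓝 1) := by
  refine tendsto_atImInfty_of_strip (jacobiEisenstein_T k z) ?_
  obtain ⟨C, hC⟩ := exists_norm_eisSummand_le hk ‖z‖ 1 one_pos
  classical
  have h1 : Tendsto (fun τ : ℍ => ∑' x, eisSummand k z τ x)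
      (UpperHalfPlane.atImInfty ⊓ 𝓟 {τ | |τ.re| ≤ 1})
      (𝓝 (∑' x : CoprimePair × ℤ, if x.1.1 0 = 0 ∧ x.2 = 0 then 1 else 0)) := by
    refine tendsto_tsum_of_dominated_convergence (summable_eisMajorant.mul_left C)
      (fun x => ?_) ?_
    · split_ifs with h
      · refine tendsto_const_nhds.congr fun τ => ?_
        obtain ⟨v, l⟩ := x
        obtain ⟨hv, rfl⟩ : v.1 0 = 0 ∧ l = 0 := h
        exact (eisSummand_of_zero hk2 z τ v hv).symm
      · exact tendsto_eisSummand hk z _ x h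
    · have hy : ∀ᶠ τ : ℍ in UpperHalfPlane.atImInfty ⊓ 𝓟 {τ : ℍ | |τ.re| ≤ 1}, 1 ≤ τ.im :=
        (tendsto_im_atImInfty_strip _).eventually (eventually_ge_atTop 1)
      have hs : ∀ᶠ τ : ℍ in UpperHalfPlane.atImInfty ⊓ 𝓟 {τ : ℍ | |τ.re| ≤ 1}, |τ.re| ≤ 1 :=
        mem_inf_of_right (mem_principal_self _)
      filter_upwards [hy, hs] with τ h2 h3 x
      exact hC z τ le_rfl h3 h2 x
  -- The surviving terms are (c, d) = (0, ±1) with l = 0; the factor 1/2 in the definition makes the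
  -- limit 1.
  have h2 : (∑' x : CoprimePair × ℤ, if x.1.1 0 = 0 ∧ x.2 = 0 then (1 : ℂ) else 0) = 2 := by
    let p : CoprimePair := ⟨![0, 1], by simpa using isCoprime_one_right⟩
    let m : CoprimePair := ⟨![0, -1], by simpa using isCoprime_zero_left.2 isUnit_one.neg⟩
    have hpm : (p, (0 : ℤ)) ≠ (m, 0) := fun h => by
      have := congrFun (congrArg Subtype.val (congrArg Prod.fst h)) 1
      simp [p, m] at this
    rw [tsum_eq_sum (s := {(p, 0), (m, 0)}), Finset.sum_pair hpm]
    · simp [p, m]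
      norm_num
    · intro x hx
      rw [if_neg]
      rintro ⟨hv, hl⟩
      apply hx
      have hu := x.1.2
      rw [hv, isCoprime_zero_left] at hu
      have hx' : ∀ q : CoprimePair, x.1.1 0 = q.1 0 → x.1.1 1 = q.1 1 → x = (q, 0) :=
        fun q h0 h1 => by
          refine Prod.ext (Subtype.ext (funext fun i => ?_)) hl
          fin_cases i
          · exact h0
          · exact h1
      rcases Int.isUnit_iff.1 hu with h | h
      · simp [hx' p (by simp [p, hv]) (by simp [p, h])]
      · simp [hx' m (by simp [m, hv]) (by simp [m, h])]
  rw [h2] at h1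
  have h3 := h1.const_mul (1 / 2)
  norm_num at h3
  refine h3.congr fun τ => ?_
  rw [jacobiEisenstein_eq_tsum hk]

/-! ### Modular forms of level one -/

/-- Holomorphic functions on `ℍ` which are invariant of weight `k` under `SL(2, ℤ)`, with no
condition at the cusp. -/
structure IsWeaklyModular (k : ℤ) (f : ℍ → ℂ) : Prop where
  mdifferentiable : MDiff f
  T_smul (τ : ℍ) : f (ModularGroup.T • τ) = f τ
  S_smul (τ : ℍ) : f (ModularGroup.S • τ) = (τ : ℂ) ^ k * f τ

theorem slash_T (k : ℤ) (f : ℍ → ℂ) (τ : ℍ) :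
    (f ∣[k] ModularGroup.T) τ = f (ModularGroup.T • τ) := by
  have h0 : ModularGroup.T 1 0 = 0 := by simp [ModularGroup.T]
  have h1 : ModularGroup.T 1 1 = 1 := by simp [ModularGroup.T]
  rw [ModularForm.SL_slash_apply, ModularGroup.denom_apply, h0, h1]
  simp

theorem slash_S (k : ℤ) (f : ℍ → ℂ) (τ : ℍ) :
    (f ∣[k] ModularGroup.S) τ = f (ModularGroup.S • τ) * (τ : ℂ) ^ (-k) := by
  rw [ModularForm.SL_slash_apply, ModularGroup.denom_S]

theorem IsWeaklyModular.slash {k : ℤ} {f : ℍ → ℂ} (hf : IsWeaklyModular k f) (γ : SL(2, ℤ)) :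
    f ∣[k] γ = f := by
  refine SlashInvariantForm.slash_action_generators_SL2Z ?_ ?_ γ
  · ext τ
    rw [slash_S, hf.S_smul, zpow_neg, mul_comm, ← mul_assoc,
      inv_mul_cancel₀ (zpow_ne_zero _ τ.ne_zero), one_mul]
  · ext τ
    rw [slash_T, hf.T_smul]

/-- Vanishing at the cusp makes f a cusp form, and there are none of weight below 12. All Taylor
coefficients below are identified in this way. -/
theorem IsWeaklyModular.eq_zero {k : ℤ} {f : ℍ → ℂ} (hf : IsWeaklyModular k f) (hk : k < 12)
    (h0 : Tendsto f UpperHalfPlane.atImInfty (𝓝 0)) (τ : ℍ) : f τ = 0 := by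
  let F : CuspForm 𝒮ℒ k :=
    { toFun := f
      slash_action_eq' := fun A hA => by
        obtain ⟨A, rfl⟩ := hA
        exact hf.slash A
      holo' := hf.mdifferentiable
      zero_at_cusps' := fun hc => by
        rw [Subgroup.IsArithmetic.isCusp_iff_isCusp_SL2Z] at hc
        rw [OnePoint.isZeroAt_iff_forall_SL2Z hc]
        intro γ _
        rw [hf.slash γ]
        exact h0 }
  have h := rank_zero_iff_forall_zero.mp (CuspForm.rank_eq_zero_of_weight_lt_twelve hk) F
  exact congrArg (fun G : CuspForm 𝒮ℒ k => G τ) h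

theorem isWeaklyModular_modularForm {k : ℤ} (f : ModularForm 𝒮ℒ k) : IsWeaklyModular k f where
  mdifferentiable := f.holo'
  T_smul τ := by
    have h := congrFun (f.slash_action_eq' _ ⟨ModularGroup.T, rfl⟩) τ
    exact (slash_T k f τ).symm.trans h
  S_smul τ := by
    have h := (slash_S k f τ).symm.trans (congrFun (f.slash_action_eq' _ ⟨ModularGroup.S, rfl⟩) τ)
    have h' : f τ = f (ModularGroup.S • τ) * (τ : ℂ) ^ (-k) := h.symm
    rw [h', mul_comm, mul_assoc, ← zpow_add₀ τ.ne_zero]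
    simp

/-! ### Limits of Eisenstein series at the cusp and the quasimodularity of E₂. -/

theorem tendsto_of_hasSum_qExpansion {f : ℍ → ℂ} {c : ℕ → ℂ}
    (hf : ∀ τ : ℍ, HasSum (fun m => c m • Function.Periodic.qParam 1 τ ^ m) (f τ)) :
    Tendsto f UpperHalfPlane.atImInfty (𝓝 (c 0)) := by
  have hq := UpperHalfPlane.qParam_tendsto_atImInfty zero_lt_one
  have hb : ∀ᶠ τ : ℍ in UpperHalfPlane.atImInfty,
      ‖Function.Periodic.qParam 1 τ‖ ≤ ‖Function.Periodic.qParam 1 UpperHalfPlane.I‖ := by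
    have h1 : 0 < ‖Function.Periodic.qParam 1 UpperHalfPlane.I‖ :=
      norm_pos_iff.2 (Function.Periodic.qParam_ne_zero _)
    filter_upwards [hq.norm.eventually (gt_mem_nhds (by rw [norm_zero]; exact h1))] with τ h using h.le
  -- Near the cusp |q| is at most its value at τ = i, so the series at i dominates.
  have hs := (hf UpperHalfPlane.I).summable.norm
  have h := tendsto_tsum_of_dominated_convergence (𝓕 := UpperHalfPlane.atImInfty)
    (f := fun (τ : ℍ) (m : ℕ) => c m • Function.Periodic.qParam 1 τ ^ m)
    (g := fun m => c m • (0 : ℂ) ^ m) hs (fun m => (hq.pow m).const_smul (c m)) (by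
      filter_upwards [hb] with τ h m
      rw [norm_smul, norm_smul, norm_pow, norm_pow]
      gcongr)
  rw [tsum_eq_single 0 (fun m hm => by simp [hm])] at h
  simp only [pow_zero, smul_eq_mul, mul_one] at h
  exact h.congr fun τ => (hf τ).tsum_eq

theorem tendsto_eisenstein {k : ℕ} (hk : 3 ≤ k) (hk2 : Even k) :
    Tendsto (ModularForm.E hk) UpperHalfPlane.atImInfty (𝓝 1) := by
  have h := tendsto_of_hasSum_qExpansion fun τ =>
    UpperHalfPlane.hasSum_qExpansion one_pos
      (SlashInvariantFormClass.periodic_comp_ofComplex (ModularForm.E hk)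
        (by simp))
      (ModularFormClass.holo _) (ModularFormClass.bdd_at_infty _) τ
  rwa [EisensteinSeries.E_qExpansion_coeff_zero hk hk2] at h

theorem tendsto_E2 : Tendsto EisensteinSeries.E2 UpperHalfPlane.atImInfty (𝓝 1) := by
  have h := tendsto_of_hasSum_qExpansion (f := EisensteinSeries.E2) fun τ => by
    simpa only [Function.Periodic.qParam, Complex.ofReal_one, div_one] using
      EisensteinSeries.hasSum_qExpansion_E2 (z := τ)
  simpa using h

theorem E2_T_smul (τ : ℍ) :
    EisensteinSeries.E2 (ModularGroup.T • τ) = EisensteinSeries.E2 τ := by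
  rw [← slash_T 2 EisensteinSeries.E2, EisensteinSeries.E2_slash_action, EisensteinSeries.D2_T]
  simp

/-- The anomaly comes from the slash action on E₂ with ζ(2) = π²/6; it is the source of the φ_{0,1}
term in the transformation of E_{2,1}. -/
theorem E2_S_smul (τ : ℍ) :
    EisensteinSeries.E2 (ModularGroup.S • τ) =
      (τ : ℂ) ^ 2 * EisensteinSeries.E2 τ + 12 * τ / (2 * π * Complex.I) := by
  have h := congrFun (EisensteinSeries.E2_slash_action ModularGroup.S) τ
  rw [slash_S, Pi.sub_apply, Pi.smul_apply, EisensteinSeries.D2_S, riemannZeta_two] at h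
  have hτ := τ.ne_zero
  have hpi : (π : ℂ) ≠ 0 := by exact_mod_cast Real.pi_ne_zero
  rw [zpow_neg, ← div_eq_mul_inv, div_eq_iff (zpow_ne_zero _ hτ)] at h
  rw [h, smul_eq_mul]
  norm_cast
  push_cast
  field_simp
  linear_combination (-12 : ℂ) * Complex.I_sq

/-! ### Holomorphic dependence on the modular variable -/

theorem mdifferentiable_theta {ε : ℕ} (hε : ε ≤ 1) (j : ℕ) (z : ℂ) :
    MDiff (fun τ : ℍ => theta ε j z τ) := by
  rw [UpperHalfPlane.mdifferentiable_iff]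
  refine DifferentiableOn.congr (f := fun τ => theta ε j z τ)
    (fun τ hτ => (differentiableAt_theta_right hε j z hτ).differentiableWithinAt) fun τ hτ => ?_
  simp [UpperHalfPlane.ofComplex_apply_of_im_pos hτ]

theorem differentiableAt_of_mul {a b w : ℍ → ℂ}
    (ha : MDiff a) (hb : MDiff b) (h : ∀ τ, w τ * a τ = b τ) (τ : ℍ) (hτ : a τ ≠ 0) :
    DifferentiableAt ℂ (w ∘ UpperHalfPlane.ofComplex) τ := by
  rw [UpperHalfPlane.mdifferentiable_iff] at ha hb
  have ho : {z : ℂ | 0 < z.im} ∈ 𝓝 (τ : ℂ) := UpperHalfPlane.isOpen_upperHalfPlaneSet.mem_nhds τ.2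
  have ha' := ha.differentiableAt ho
  have hb' := hb.differentiableAt ho
  have hne : (a ∘ UpperHalfPlane.ofComplex) τ ≠ 0 := by simpa using hτ
  refine (hb'.div ha' hne).congr_of_eventuallyEq ?_
  filter_upwards [ha'.continuousAt.eventually_ne hne] with z hz
  exact (eq_div_iff hz).2 (h _)

/-- Near a given τ, w is the quotient of G(z) by θ_ε(z, ·) for any z at which θ_ε does not vanish.
This restores holomorphy for coefficients chosen separately for each τ. -/
theorem mdifferentiable_of_mul_theta {ε : ℕ} (hε : ε ≤ 1) {w : ℍ → ℂ} {G : ℂ → ℍ → ℂ}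
    (hG : ∀ z, MDiff (G z)) (h : ∀ z τ, w τ * theta ε 0 z τ = G z τ) : MDiff w := by
  rw [UpperHalfPlane.mdifferentiable_iff]
  intro τ hτ
  obtain ⟨z, hz⟩ := exists_theta_ne_zero hε hτ
  exact (differentiableAt_of_mul (mdifferentiable_theta hε 0 z) (hG z) (h z) ⟨τ, hτ⟩
    hz).differentiableWithinAt

theorem coe_T_smul (τ : ℍ) : ((ModularGroup.T • τ : ℍ) : ℂ) = τ + 1 := by
  rw [UpperHalfPlane.modular_T_smul, UpperHalfPlane.coe_vadd, add_comm]
  simp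

theorem T_smul_of_mul_theta {ε : ℕ} (hε : ε ≤ 1) {w : ℍ → ℂ} {G : ℂ → ℍ → ℂ}
    (hG : ∀ z τ, G z (ModularGroup.T • τ) = G z τ) (h : ∀ z τ, w τ * theta ε 0 z τ = G z τ)
    (τ : ℍ) : w (ModularGroup.T • τ) = w τ := by
  obtain ⟨z, hz⟩ := exists_theta_ne_zero hε τ.2
  have h1 := h z (ModularGroup.T • τ)
  rw [hG, ← h z τ, coe_T_smul, theta_right_add_one] at h1
  exact mul_right_cancel₀ hz h1

/-- Half the sum and half the difference of the values at z and z + 1/2 isolate u θ₀ and v θ₁, so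
all properties of u and v follow from those of E_{k,1} by division. Both values tend to 1 at the
cusp, hence the limits 1 and 0. -/
theorem exists_jacobiEisenstein_eq_theta {k : ℕ} (hk : 4 ≤ k) (hk2 : Even k) :
    ∃ u v : ℍ → ℂ, MDiff u ∧ MDiff v ∧ (∀ τ, u (ModularGroup.T • τ) = u τ) ∧
      (∀ τ, v (ModularGroup.T • τ) = v τ) ∧ Tendsto u UpperHalfPlane.atImInfty (𝓝 1) ∧
      Tendsto v UpperHalfPlane.atImInfty (𝓝 0) ∧
      ∀ z τ, jacobiEisenstein k z τ = u τ * theta 0 0 z τ + v τ * theta 1 0 z τ := by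
  choose u v h using fun τ : ℍ => exists_eq_theta τ.2 (differentiable_jacobiEisenstein hk τ)
    (fun z => jacobiEisenstein_add_one k z τ) (fun z => jacobiEisenstein_add_tau k z τ)
  have hu (z : ℂ) (τ : ℍ) : u τ * theta 0 0 z τ =
      (jacobiEisenstein k z τ + jacobiEisenstein k (z + 1 / 2) τ) / 2 := by
    rw [h, h, theta_add_half, theta_add_half]
    ring
  have hv (z : ℂ) (τ : ℍ) : v τ * theta 1 0 z τ =
      (jacobiEisenstein k z τ - jacobiEisenstein k (z + 1 / 2) τ) / 2 := by
    rw [h, h, theta_add_half, theta_add_half]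
    ring
  have hd := fun z => mdifferentiable_jacobiEisenstein hk z
  have hlim := fun z => tendsto_jacobiEisenstein hk hk2 z
  have h0 : Tendsto (fun τ : ℍ => theta 0 0 0 τ) UpperHalfPlane.atImInfty (𝓝 1) := by
    simpa using tendsto_theta_even_atImInfty 0
  have h1 : Tendsto (fun τ : ℍ => theta 1 0 0 τ) UpperHalfPlane.atImInfty (𝓝 2) := by
    simpa [one_add_one_eq_two] using tendsto_theta_odd_atImInfty 0
  refine ⟨u, v, mdifferentiable_of_mul_theta zero_le_one (fun z => ?_) hu,
    mdifferentiable_of_mul_theta le_rfl (fun z => ?_) hv,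
    T_smul_of_mul_theta zero_le_one (fun z τ => ?_) hu,
    T_smul_of_mul_theta le_rfl (fun z τ => ?_) hv, ?_, ?_, fun z τ => h τ z⟩
  · have h1 := UpperHalfPlane.mdifferentiable_iff.1 (hd z)
    have h2 := UpperHalfPlane.mdifferentiable_iff.1 (hd (z + 1 / 2))
    exact UpperHalfPlane.mdifferentiable_iff.2 ((h1.add h2).div_const 2)
  · have h1 := UpperHalfPlane.mdifferentiable_iff.1 (hd z)
    have h2 := UpperHalfPlane.mdifferentiable_iff.1 (hd (z + 1 / 2))
    exact UpperHalfPlane.mdifferentiable_iff.2 ((h1.sub h2).div_const 2)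
  · simp only [jacobiEisenstein_T]
  · simp only [jacobiEisenstein_T]
  · have := (((hlim 0).add (hlim (0 + 1 / 2))).div_const 2).div h0 one_ne_zero
    norm_num at this
    refine this.congr' ?_
    filter_upwards [h0.eventually_ne one_ne_zero] with τ hτ
    have := hu 0 τ
    norm_num at this
    rw [Pi.div_apply, ← this]
    exact mul_div_cancel_right₀ _ hτ
  · have := (((hlim 0).sub (hlim (0 + 1 / 2))).div_const 2).div h1 two_ne_zero
    norm_num at this
    refine this.congr' ?_
    filter_upwards [h1.eventually_ne two_ne_zero] with τ hτ
    have := hv 0 τ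
    norm_num at this
    rw [Pi.div_apply, ← this]
    exact mul_div_cancel_right₀ _ hτ

/-! ### Algebra of weakly modular functions. -/

theorem IsWeaklyModular.mul {k l : ℤ} {f g : ℍ → ℂ} (hf : IsWeaklyModular k f)
    (hg : IsWeaklyModular l g) : IsWeaklyModular (k + l) (fun τ => f τ * g τ) where
  mdifferentiable := hf.mdifferentiable.mul hg.mdifferentiable
  T_smul τ := by rw [hf.T_smul, hg.T_smul]
  S_smul τ := by
    rw [hf.S_smul, hg.S_smul, zpow_add₀ τ.ne_zero]
    ring

theorem IsWeaklyModular.sub {k : ℤ} {f g : ℍ → ℂ} (hf : IsWeaklyModular k f)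
    (hg : IsWeaklyModular k g) : IsWeaklyModular k (fun τ => f τ - g τ) where
  mdifferentiable := hf.mdifferentiable.sub hg.mdifferentiable
  T_smul τ := by rw [hf.T_smul, hg.T_smul]
  S_smul τ := by rw [hf.S_smul, hg.S_smul, mul_sub]

theorem IsWeaklyModular.inv {k : ℤ} {f : ℍ → ℂ} (hf : IsWeaklyModular k f)
    (h0 : ∀ τ, f τ ≠ 0) : IsWeaklyModular (-k) (fun τ => (f τ)⁻¹) where
  mdifferentiable := UpperHalfPlane.mdifferentiable_iff.2
    ((UpperHalfPlane.mdifferentiable_iff.1 hf.mdifferentiable).inv fun τ _ => h0 _)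
  T_smul τ := by rw [hf.T_smul]
  S_smul τ := by rw [hf.S_smul, mul_inv, zpow_neg]

theorem isWeaklyModular_const (c : ℂ) : IsWeaklyModular 0 (fun _ => c) where
  mdifferentiable := mdifferentiable_const
  T_smul _ := rfl
  S_smul _ := by simp

theorem isWeaklyModular_discriminant : IsWeaklyModular 12 ModularForm.discriminant where
  mdifferentiable := CuspForm.discriminant.holo'
  T_smul τ := by rw [← slash_T 12 ModularForm.discriminant, ModularForm.discriminant_T_invariant]
  S_smul τ := by
    have h := congrFun ModularForm.discriminant_S_invariant τ
    rw [slash_S] at h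
    rw [← h, mul_comm, mul_assoc, ← zpow_add₀ τ.ne_zero]
    simp

/-! ### Decomposition along theta functions -/

/-- `F` is a combination of the two theta functions of index one, with coefficients which are
holomorphic and `1`-periodic in `τ`. -/
structure HasThetaDecomp (F : ℂ → ℍ → ℂ) (u v : ℍ → ℂ) : Prop where
  mdifferentiable_left : MDiff u
  mdifferentiable_right : MDiff v
  T_smul_left (τ : ℍ) : u (ModularGroup.T • τ) = u τ
  T_smul_right (τ : ℍ) : v (ModularGroup.T • τ) = v τ
  eq (z : ℂ) (τ : ℍ) : F z τ = u τ * theta 0 0 z τ + v τ * theta 1 0 z τ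

/-- The `j`-th Taylor coefficient at `z = 0`, up to the factor `(2 π i) ^ j / j!`, of
`u θ₀ + v θ₁`. -/
def thetaCoeff (u v : ℍ → ℂ) (j : ℕ) (τ : ℍ) : ℂ := u τ * theta 0 j 0 τ + v τ * theta 1 j 0 τ

/-- The modular transformation law of Jacobi forms of weight `k` and index `1`. -/
def HasJacobiS (k : ℤ) (F : ℂ → ℍ → ℂ) : Prop :=
  ∀ (z : ℂ) (τ : ℍ), F (z / τ) (ModularGroup.S • τ) =
    (τ : ℂ) ^ k * Complex.exp (2 * π * Complex.I * (z ^ 2 / τ)) * F z τ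

/-! ### Taylor coefficients under z ↦ z / τ. -/

theorem hasDerivAt_thetaComb (a b : ℂ) (j : ℕ) (τ : ℍ) (z : ℂ) :
    HasDerivAt (fun z => a * theta 0 j z τ + b * theta 1 j z τ)
      (2 * π * Complex.I * (a * theta 0 (j + 1) z τ + b * theta 1 (j + 1) z τ)) z := by
  refine (((hasDerivAt_theta zero_le_one j z τ.2).const_mul a).add
    ((hasDerivAt_theta le_rfl j z τ.2).const_mul b)).congr_deriv ?_
  ring

/-- The derivative of a law with a Gaussian factor is again such a law, so differentiation can be
iterated. -/
theorem deriv_gaussian_law {s t c A : ℂ} {G G' B B' : ℂ → ℂ}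
    (hG : ∀ z, HasDerivAt G (s * G' z) z) (hB : ∀ z, HasDerivAt B (B' z) z)
    (h : ∀ z, c * G (z / t) = A * Complex.exp (s * (z ^ 2 / t)) * B z) (z : ℂ) :
    c * s / t * G' (z / t) =
      A * Complex.exp (s * (z ^ 2 / t)) * (B' z + s * (2 / t) * z * B z) := by
  have h1 : HasDerivAt (fun z => c * G (z / t)) (c * (s * G' (z / t) * (1 / t))) z :=
    ((hG (z / t)).comp z ((hasDerivAt_id z).div_const t)).const_mul c
  have h2 : HasDerivAt (fun z => A * Complex.exp (s * (z ^ 2 / t)) * B z)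
      (A * (Complex.exp (s * (z ^ 2 / t)) * (s * (2 * z / t))) * B z +
        A * Complex.exp (s * (z ^ 2 / t)) * B' z) z := by
    have h3 : HasDerivAt (fun z : ℂ => s * (z ^ 2 / t)) (s * (2 * z / t)) z := by
      simpa using ((hasDerivAt_pow 2 z).div_const t).const_mul s
    exact (h3.cexp.const_mul A).mul (hB z)
  have h4 := (h1.congr_of_eventuallyEq (Eventually.of_forall fun z => (h z).symm)).unique h2
  linear_combination h4

/-- Four differentiations, then z = 0. The numbers 2, 12, 12 come from Leibniz's rule for exp(s z² /
t) H(z); the odd derivatives of H carry a factor z and drop out. -/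
theorem taylor_gaussian_law {s t A : ℂ} (hs : s ≠ 0) (ht : t ≠ 0) {G H : ℕ → ℂ → ℂ}
    (hG : ∀ j z, HasDerivAt (G j) (s * G (j + 1) z) z)
    (hH : ∀ j z, HasDerivAt (H j) (s * H (j + 1) z) z)
    (h : ∀ z, G 0 (z / t) = A * Complex.exp (s * (z ^ 2 / t)) * H 0 z) :
    G 0 0 = A * H 0 0 ∧ G 2 0 = A * t ^ 2 * (H 2 0 + 2 / (s * t) * H 0 0) ∧
      G 4 0 = A * t ^ 4 * (H 4 0 + 12 / (s * t) * H 2 0 + 12 / (s * t) ^ 2 * H 0 0) := by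
  have hid := fun z : ℂ => hasDerivAt_id z
  have b1 (z : ℂ) : HasDerivAt
      (fun z => s * H 1 z + s * (2 / t) * z * H 0 z)
      (s * (s * H 2 z) + (s * (2 / t) * 1 * H 0 z + s * (2 / t) * z * (s * H 1 z))) z :=
    ((hH 1 z).const_mul s).add (((hid z).const_mul (s * (2 / t))).mul (hH 0 z))
  have e1 := deriv_gaussian_law (c := 1) (hG 0) (hH 0) (by simpa using h)
  have e2 := deriv_gaussian_law (hG 1) b1 e1
  have b2 (z : ℂ) : HasDerivAt
      (fun z => s ^ 2 * H 2 z + 2 * s ^ 2 * (2 / t) * z * H 1 z +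
        (s * (2 / t) + s ^ 2 * (2 / t) ^ 2 * z ^ 2) * H 0 z)
      (s ^ 2 * (s * H 3 z) + (2 * s ^ 2 * (2 / t) * 1 * H 1 z +
          2 * s ^ 2 * (2 / t) * z * (s * H 2 z)) +
        ((s ^ 2 * (2 / t) ^ 2 * (2 * z)) * H 0 z +
          (s * (2 / t) + s ^ 2 * (2 / t) ^ 2 * z ^ 2) * (s * H 1 z))) z := by
    have hp : HasDerivAt (fun z : ℂ => s * (2 / t) + s ^ 2 * (2 / t) ^ 2 * z ^ 2)
        (s ^ 2 * (2 / t) ^ 2 * (2 * z)) z := by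
      simpa using ((hasDerivAt_pow 2 z).const_mul (s ^ 2 * (2 / t) ^ 2)).const_add (s * (2 / t))
    exact (((hH 2 z).const_mul (s ^ 2)).add
      (((hid z).const_mul (2 * s ^ 2 * (2 / t))).mul (hH 1 z))).add (hp.mul (hH 0 z))
  have e2' (z : ℂ) : 1 * s / t * s / t * G 2 (z / t) = A * Complex.exp (s * (z ^ 2 / t)) *
      (s ^ 2 * H 2 z + 2 * s ^ 2 * (2 / t) * z * H 1 z +
        (s * (2 / t) + s ^ 2 * (2 / t) ^ 2 * z ^ 2) * H 0 z) := by
    rw [e2]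
    ring
  have e3 := deriv_gaussian_law (hG 2) b2 e2'
  have b3 (z : ℂ) : HasDerivAt
      (fun z => s ^ 3 * H 3 z + 3 * s ^ 3 * (2 / t) * z * H 2 z +
        (3 * s ^ 2 * (2 / t) + 3 * s ^ 3 * (2 / t) ^ 2 * z ^ 2) * H 1 z +
        (3 * s ^ 2 * (2 / t) ^ 2 * z + s ^ 3 * (2 / t) ^ 3 * z ^ 3) * H 0 z)
      (s ^ 3 * (s * H 4 z) + (3 * s ^ 3 * (2 / t) * 1 * H 2 z +
          3 * s ^ 3 * (2 / t) * z * (s * H 3 z)) +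
        ((3 * s ^ 3 * (2 / t) ^ 2 * (2 * z)) * H 1 z +
          (3 * s ^ 2 * (2 / t) + 3 * s ^ 3 * (2 / t) ^ 2 * z ^ 2) * (s * H 2 z)) +
        ((3 * s ^ 2 * (2 / t) ^ 2 * 1 + s ^ 3 * (2 / t) ^ 3 * (3 * z ^ 2)) * H 0 z +
          (3 * s ^ 2 * (2 / t) ^ 2 * z + s ^ 3 * (2 / t) ^ 3 * z ^ 3) * (s * H 1 z))) z := by
    have hp : HasDerivAt (fun z : ℂ => 3 * s ^ 2 * (2 / t) + 3 * s ^ 3 * (2 / t) ^ 2 * z ^ 2)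
        (3 * s ^ 3 * (2 / t) ^ 2 * (2 * z)) z := by
      simpa using ((hasDerivAt_pow 2 z).const_mul (3 * s ^ 3 * (2 / t) ^ 2)).const_add
        (3 * s ^ 2 * (2 / t))
    have hq : HasDerivAt
        (fun z : ℂ => 3 * s ^ 2 * (2 / t) ^ 2 * z + s ^ 3 * (2 / t) ^ 3 * z ^ 3)
        (3 * s ^ 2 * (2 / t) ^ 2 * 1 + s ^ 3 * (2 / t) ^ 3 * (3 * z ^ 2)) z := by
      have h3 : HasDerivAt (fun z : ℂ => z ^ 3) (3 * z ^ 2) z := by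
        simpa using hasDerivAt_pow 3 z
      exact ((hid z).const_mul _).add (h3.const_mul _)
    exact ((((hH 3 z).const_mul (s ^ 3)).add
      (((hid z).const_mul (3 * s ^ 3 * (2 / t))).mul (hH 2 z))).add (hp.mul (hH 1 z))).add
      (hq.mul (hH 0 z))
  have e3' (z : ℂ) : 1 * s / t * s / t * s / t * G 3 (z / t) =
      A * Complex.exp (s * (z ^ 2 / t)) *
      (s ^ 3 * H 3 z + 3 * s ^ 3 * (2 / t) * z * H 2 z +
        (3 * s ^ 2 * (2 / t) + 3 * s ^ 3 * (2 / t) ^ 2 * z ^ 2) * H 1 z +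
        (3 * s ^ 2 * (2 / t) ^ 2 * z + s ^ 3 * (2 / t) ^ 3 * z ^ 3) * H 0 z) := by
    rw [e3]
    ring
  have e4 := deriv_gaussian_law (hG 3) b3 e3'
  refine ⟨by simpa using h 0, ?_, ?_⟩
  · have := e2' 0
    simp at this
    field_simp at this ⊢
    linear_combination this
  · have := e4 0
    simp at this
    field_simp at this ⊢
    linear_combination this

theorem HasThetaDecomp.thetaCoeff_S {F : ℂ → ℍ → ℂ} {u v : ℍ → ℂ} (hF : HasThetaDecomp F u v)
    {k : ℤ} (hS : HasJacobiS k F) (τ : ℍ) :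
    thetaCoeff u v 0 (ModularGroup.S • τ) = (τ : ℂ) ^ k * thetaCoeff u v 0 τ ∧
    thetaCoeff u v 2 (ModularGroup.S • τ) = (τ : ℂ) ^ k * (τ : ℂ) ^ 2 * (thetaCoeff u v 2 τ +
      2 / (2 * π * Complex.I * τ) * thetaCoeff u v 0 τ) ∧
    thetaCoeff u v 4 (ModularGroup.S • τ) = (τ : ℂ) ^ k * (τ : ℂ) ^ 4 * (thetaCoeff u v 4 τ +
      12 / (2 * π * Complex.I * τ) * thetaCoeff u v 2 τ +
      12 / (2 * π * Complex.I * τ) ^ 2 * thetaCoeff u v 0 τ) := by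
  refine taylor_gaussian_law Complex.two_pi_I_ne_zero τ.ne_zero (fun j z => hasDerivAt_thetaComb
    (u (ModularGroup.S • τ)) (v (ModularGroup.S • τ)) j (ModularGroup.S • τ) z)
    (fun j z => hasDerivAt_thetaComb (u τ) (v τ) j τ z) fun z => ?_
  have := hS z τ
  rwa [hF.eq, hF.eq] at this

theorem HasThetaDecomp.mdifferentiable_thetaCoeff {F : ℂ → ℍ → ℂ} {u v : ℍ → ℂ}
    (hF : HasThetaDecomp F u v) (j : ℕ) : MDiff (thetaCoeff u v j) :=
  (hF.mdifferentiable_left.mul (mdifferentiable_theta zero_le_one j 0)).add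
    (hF.mdifferentiable_right.mul (mdifferentiable_theta le_rfl j 0))

theorem HasThetaDecomp.thetaCoeff_T {F : ℂ → ℍ → ℂ} {u v : ℍ → ℂ} (hF : HasThetaDecomp F u v)
    (j : ℕ) (τ : ℍ) : thetaCoeff u v j (ModularGroup.T • τ) = thetaCoeff u v j τ := by
  simp only [thetaCoeff, hF.T_smul_left, hF.T_smul_right, coe_T_smul, theta_right_add_one]

theorem HasThetaDecomp.add {F G : ℂ → ℍ → ℂ} {u v u' v' a b : ℍ → ℂ} (hF : HasThetaDecomp F u v)
    (hG : HasThetaDecomp G u' v') (ha : MDiff a) (hb : MDiff b)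
    (haT : ∀ τ, a (ModularGroup.T • τ) = a τ) (hbT : ∀ τ, b (ModularGroup.T • τ) = b τ) :
    HasThetaDecomp (fun z τ => a τ * F z τ + b τ * G z τ) (fun τ => a τ * u τ + b τ * u' τ)
      (fun τ => a τ * v τ + b τ * v' τ) where
  mdifferentiable_left := (ha.mul hF.mdifferentiable_left).add (hb.mul hG.mdifferentiable_left)
  mdifferentiable_right := (ha.mul hF.mdifferentiable_right).add (hb.mul hG.mdifferentiable_right)
  T_smul_left τ := by rw [haT, hbT, hF.T_smul_left, hG.T_smul_left]
  T_smul_right τ := by rw [haT, hbT, hF.T_smul_right, hG.T_smul_right]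
  eq z τ := by
    rw [hF.eq, hG.eq]
    ring

theorem thetaCoeff_add (u v u' v' a b : ℍ → ℂ) (j : ℕ) (τ : ℍ) :
    thetaCoeff (fun τ => a τ * u τ + b τ * u' τ) (fun τ => a τ * v τ + b τ * v' τ) j τ =
      a τ * thetaCoeff u v j τ + b τ * thetaCoeff u' v' j τ := by
  simp only [thetaCoeff]
  ring

/-! ### Taylor coefficients of the Jacobi-Eisenstein series -/

theorem tendsto_thetaCoeff {u v : ℍ → ℂ} {a b : ℂ}
    (hu : Tendsto u UpperHalfPlane.atImInfty (𝓝 a))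
    (hv : Tendsto v UpperHalfPlane.atImInfty (𝓝 b)) (j : ℕ) :
    Tendsto (thetaCoeff u v j) UpperHalfPlane.atImInfty (𝓝 (a * 0 ^ j + b * (1 + (-1) ^ j))) :=
  (hu.mul (tendsto_theta_even_atImInfty j)).add (hv.mul (tendsto_theta_odd_atImInfty j))

/-- The order 0 coefficient minus e is a cusp form of weight k. The order 2 coefficient has anomaly
2 τ^(k+1) e / (2πi), exactly that of E₂ e / 6; subtracting this leaves weight k + 2, and e' corrects
the value at the cusp. The bound k < 10 keeps both weights below 12. -/
theorem exists_jacobiEisenstein_decomp {k : ℕ} (hk : 4 ≤ k) (hk2 : Even k) (hk' : k < 10)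
    {e e' : ℍ → ℂ} (he : IsWeaklyModular k e) (he' : IsWeaklyModular (k + 2) e')
    (hlim : Tendsto e UpperHalfPlane.atImInfty (𝓝 1))
    (hlim' : Tendsto e' UpperHalfPlane.atImInfty (𝓝 1)) :
    ∃ u v : ℍ → ℂ, HasThetaDecomp (fun z τ => jacobiEisenstein k z τ) u v ∧
      (∀ τ, thetaCoeff u v 0 τ = e τ) ∧
      ∀ τ, thetaCoeff u v 2 τ = (EisensteinSeries.E2 τ * e τ - e' τ) / 6 := by
  obtain ⟨u, v, hu, hv, huT, hvT, hul, hvl, h⟩ := exists_jacobiEisenstein_eq_theta hk hk2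
  have hF : HasThetaDecomp (fun z τ => jacobiEisenstein k z τ) u v := ⟨hu, hv, huT, hvT, h⟩
  have hS : HasJacobiS k (fun z τ => jacobiEisenstein k z τ) := fun z τ => by
    simpa using jacobiEisenstein_S k z τ
  have h0 : ∀ τ, thetaCoeff u v 0 τ = e τ := fun τ => by
    have hw : IsWeaklyModular k (thetaCoeff u v 0) :=
      ⟨hF.mdifferentiable_thetaCoeff 0, hF.thetaCoeff_T 0, fun τ => (hF.thetaCoeff_S hS τ).1⟩
    refine sub_eq_zero.1 ((hw.sub he).eq_zero (by omega) ?_ τ)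
    simpa using (tendsto_thetaCoeff hul hvl 0).sub hlim
  refine ⟨u, v, hF, h0, fun τ => ?_⟩
  have hw : IsWeaklyModular (k + 2)
      (fun τ => thetaCoeff u v 2 τ - (EisensteinSeries.E2 τ * e τ - e' τ) / 6) := by
    refine ⟨(hF.mdifferentiable_thetaCoeff 2).sub ?_, fun τ => ?_, fun τ => ?_⟩
    · have := UpperHalfPlane.mdifferentiable_iff.1
        ((E2_mdifferentiable.mul he.mdifferentiable).sub he'.mdifferentiable)
      exact UpperHalfPlane.mdifferentiable_iff.2 (this.div_const 6)
    · rw [hF.thetaCoeff_T, he.T_smul, he'.T_smul, E2_T_smul]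
    · rw [(hF.thetaCoeff_S hS τ).2.1, he.S_smul, he'.S_smul, E2_S_smul, h0,
        zpow_add₀ τ.ne_zero]
      have := τ.ne_zero
      have := Complex.two_pi_I_ne_zero
      have hpi : (π : ℂ) ≠ 0 := by exact_mod_cast Real.pi_ne_zero
      generalize (τ : ℂ) ^ (k : ℤ) = A
      norm_cast
      field_simp
      ring
  refine sub_eq_zero.1 (hw.eq_zero (by omega) ?_ τ)
  have := (tendsto_thetaCoeff hul hvl 2).sub (((tendsto_E2.mul hlim).sub hlim').div_const 6)
  simpa using this

/-! ### The weak Jacobi forms `φ_{-2,1}` and `φ_{0,1}` -/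

theorem hasJacobiS_add {k l m : ℤ} {F G : ℂ → ℍ → ℂ} {a b : ℍ → ℂ} (hF : HasJacobiS k F)
    (hG : HasJacobiS l G) (ha : IsWeaklyModular (m - k) a) (hb : IsWeaklyModular (m - l) b) :
    HasJacobiS m (fun z τ => a τ * F z τ + b τ * G z τ) := fun z τ => by
  simp only [hF z τ, hG z τ, ha.S_smul, hb.S_smul, zpow_sub₀ τ.ne_zero]
  have hk := zpow_ne_zero k τ.ne_zero
  have hl := zpow_ne_zero l τ.ne_zero
  field_simp

theorem hasJacobiS_jacobiEisenstein (k : ℕ) :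
    HasJacobiS k (fun z τ => jacobiEisenstein k z τ) := fun z τ => by
  simpa using jacobiEisenstein_S k z τ

theorem isWeaklyModular_E4_sq_div :
    IsWeaklyModular (-4) (fun τ => ModularForm.E₄ τ ^ 2 / (144 * ModularForm.discriminant τ)) := by
  have h := ((isWeaklyModular_modularForm ModularForm.E₄).mul
    (isWeaklyModular_modularForm ModularForm.E₄)).mul
    ((isWeaklyModular_const 144).mul isWeaklyModular_discriminant |>.inv
      fun τ => mul_ne_zero (by norm_num) (ModularForm.discriminant_ne_zero τ))
  convert h using 2
  · norm_num
  · rw [sq, div_eq_mul_inv]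

theorem isWeaklyModular_E4_div (c : ℂ) : IsWeaklyModular (-8)
    (fun τ => c * ModularForm.E₄ τ / (144 * ModularForm.discriminant τ)) := by
  have h := ((isWeaklyModular_const c).mul (isWeaklyModular_modularForm ModularForm.E₄)).mul
    ((isWeaklyModular_const 144).mul isWeaklyModular_discriminant |>.inv
      fun τ => mul_ne_zero (by norm_num) (ModularForm.discriminant_ne_zero τ))
  convert h using 2
  · norm_num
  · rw [div_eq_mul_inv]

theorem isWeaklyModular_E6_div (c : ℂ) : IsWeaklyModular (-6)
    (fun τ => c * ModularForm.E₆ τ / (144 * ModularForm.discriminant τ)) := by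
  have h := ((isWeaklyModular_const c).mul (isWeaklyModular_modularForm ModularForm.E₆)).mul
    ((isWeaklyModular_const 144).mul isWeaklyModular_discriminant |>.inv
      fun τ => mul_ne_zero (by norm_num) (ModularForm.discriminant_ne_zero τ))
  convert h using 2
  · norm_num
  · rw [div_eq_mul_inv]

theorem phiZero_eq : phiZero = fun z τ =>
    ModularForm.E₄ τ ^ 2 / (144 * ModularForm.discriminant τ) * jacobiEisenstein 4 z τ +
    -1 * ModularForm.E₆ τ / (144 * ModularForm.discriminant τ) * jacobiEisenstein 6 z τ := by
  ext z τ
  have := ModularForm.discriminant_ne_zero τ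
  rw [phiZero, phi12]
  field_simp
  ring

theorem phiNegTwo_eq : phiNegTwo = fun z τ =>
    1 * ModularForm.E₆ τ / (144 * ModularForm.discriminant τ) * jacobiEisenstein 4 z τ +
    -1 * ModularForm.E₄ τ / (144 * ModularForm.discriminant τ) * jacobiEisenstein 6 z τ := by
  ext z τ
  have := ModularForm.discriminant_ne_zero τ
  rw [phiNegTwo, phi10]
  field_simp
  ring

theorem hasJacobiS_phiZero : HasJacobiS 0 phiZero := by
  rw [phiZero_eq]
  exact hasJacobiS_add (hasJacobiS_jacobiEisenstein 4) (hasJacobiS_jacobiEisenstein 6)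
    isWeaklyModular_E4_sq_div (isWeaklyModular_E6_div (-1))

theorem hasJacobiS_phiNegTwo : HasJacobiS (-2) phiNegTwo := by
  rw [phiNegTwo_eq]
  exact hasJacobiS_add (hasJacobiS_jacobiEisenstein 4) (hasJacobiS_jacobiEisenstein 6)
    (isWeaklyModular_E6_div 1) (isWeaklyModular_E4_div (-1))

/-! ### Recovering theta coefficients from Taylor coefficients. -/

/-- The Wronskian of the two theta functions of index one at `z = 0`. -/
def thetaWronskian (τ : ℍ) : ℂ := theta 0 0 0 τ * theta 1 2 0 τ - theta 1 0 0 τ * theta 0 2 0 τ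

theorem tendsto_thetaWronskian :
    Tendsto thetaWronskian UpperHalfPlane.atImInfty (𝓝 2) := by
  have := ((tendsto_theta_even_atImInfty 0).mul (tendsto_theta_odd_atImInfty 2)).sub
    ((tendsto_theta_odd_atImInfty 0).mul (tendsto_theta_even_atImInfty 2))
  norm_num at this
  exact this

theorem mul_thetaWronskian_left (u v : ℍ → ℂ) (τ : ℍ) : u τ * thetaWronskian τ =
    thetaCoeff u v 0 τ * theta 1 2 0 τ - theta 1 0 0 τ * thetaCoeff u v 2 τ := by
  simp only [thetaWronskian, thetaCoeff]
  ring

theorem mul_thetaWronskian_right (u v : ℍ → ℂ) (τ : ℍ) : v τ * thetaWronskian τ =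
    theta 0 0 0 τ * thetaCoeff u v 2 τ - thetaCoeff u v 0 τ * theta 0 2 0 τ := by
  simp only [thetaWronskian, thetaCoeff]
  ring

/-- Cramer's rule; the Wronskian tends to 2, so it is nonzero near the cusp. -/
theorem tendsto_of_tendsto_thetaCoeff {u v : ℍ → ℂ} {a b : ℂ}
    (ha : Tendsto (thetaCoeff u v 0) UpperHalfPlane.atImInfty (𝓝 a))
    (hb : Tendsto (thetaCoeff u v 2) UpperHalfPlane.atImInfty (𝓝 b)) :
    Tendsto u UpperHalfPlane.atImInfty (𝓝 (a - b)) ∧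
      Tendsto v UpperHalfPlane.atImInfty (𝓝 (b / 2)) := by
  have hW := tendsto_thetaWronskian
  have hW0 := hW.eventually_ne two_ne_zero
  have h0 := tendsto_theta_even_atImInfty 0
  have h1 := tendsto_theta_odd_atImInfty 0
  have h2 := tendsto_theta_even_atImInfty 2
  have h3 := tendsto_theta_odd_atImInfty 2
  constructor
  · have h := ((ha.mul h3).sub (h1.mul hb)).div hW two_ne_zero
    have e : (a * (1 + (-1) ^ 2) - (1 + (-1) ^ 0) * b) / 2 = a - b := by ring
    rw [e] at h
    refine h.congr' ?_
    filter_upwards [hW0] with τ hτ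
    exact (eq_div_of_mul_eq hτ (mul_thetaWronskian_left u v τ)).symm
  · have h := ((h0.mul hb).sub (ha.mul h2)).div hW two_ne_zero
    have e : ((0 : ℂ) ^ 0 * b - a * 0 ^ 2) / 2 = b / 2 := by ring
    rw [e] at h
    refine h.congr' ?_
    filter_upwards [hW0] with τ hτ
    exact (eq_div_of_mul_eq hτ (mul_thetaWronskian_right u v τ)).symm

/-- Everything reduces to E₄³ - E₆² = 1728 Δ, with 1728 / 144 = 12 and 1728 / (6 · 144) = 2. -/
theorem exists_phi_decomp : ∃ u v u' v' : ℍ → ℂ,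
    HasThetaDecomp phiZero u v ∧ HasThetaDecomp phiNegTwo u' v' ∧
    (∀ τ, thetaCoeff u v 0 τ = 12) ∧ (∀ τ, thetaCoeff u v 2 τ = 2 * EisensteinSeries.E2 τ) ∧
    (∀ τ, thetaCoeff u' v' 0 τ = 0) ∧ (∀ τ, thetaCoeff u' v' 2 τ = 2) := by
  have w4 := isWeaklyModular_modularForm ModularForm.E₄
  have w6 := isWeaklyModular_modularForm ModularForm.E₆
  have t4 : Tendsto ModularForm.E₄ UpperHalfPlane.atImInfty (𝓝 1) :=
    tendsto_eisenstein _ (by decide)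
  have t6 : Tendsto ModularForm.E₆ UpperHalfPlane.atImInfty (𝓝 1) :=
    tendsto_eisenstein _ (by decide)
  obtain ⟨u4, v4, h4, h40, h42⟩ := exists_jacobiEisenstein_decomp (k := 4) le_rfl (by decide)
    (by norm_num) w4 w6 t4 t6
  -- E₄² stands in for the Eisenstein series of weight 8.
  obtain ⟨u6, v6, h6, h60, h62⟩ := exists_jacobiEisenstein_decomp (k := 6) (by norm_num)
    (by decide) (by norm_num) w6 (w4.mul w4) t6 (by simpa using t4.mul t4)
  have hD := ModularForm.discriminant_ne_zero
  have hE := ModularForm.discriminant_eq_E₄_cube_sub_E₆_sq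
  have a1 := isWeaklyModular_E4_sq_div
  have a2 := isWeaklyModular_E6_div (-1)
  have b1 := isWeaklyModular_E6_div 1
  have b2 := isWeaklyModular_E4_div (-1)
  refine ⟨_, _, _, _, phiZero_eq ▸ h4.add h6 a1.mdifferentiable a2.mdifferentiable a1.T_smul
    a2.T_smul, phiNegTwo_eq ▸ h4.add h6 b1.mdifferentiable b2.mdifferentiable b1.T_smul
    b2.T_smul, fun τ => ?_, fun τ => ?_, fun τ => ?_, fun τ => ?_⟩
  · rw [thetaCoeff_add, h40, h60]
    have := hD τ
    field_simp
    linear_combination (-1728) * hE τ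
  · rw [thetaCoeff_add, h42, h62]
    have := hD τ
    field_simp
    linear_combination (-1728 * EisensteinSeries.E2 τ) * hE τ
  · rw [thetaCoeff_add, h40, h60]
    have := hD τ
    field_simp
    ring
  · rw [thetaCoeff_add, h42, h62]
    have := hD τ
    field_simp
    linear_combination (-1728) * hE τ

/-- The theta coefficients of `φ_{0,1}` and `φ_{-2,1}` and the start of their Taylor expansions
at `z = 0`. -/
structure PhiDecomp (u v u' v' : ℍ → ℂ) : Prop where
  decompZero : HasThetaDecomp phiZero u v
  decompNegTwo : HasThetaDecomp phiNegTwo u' v'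
  zero_coeff_zero (τ : ℍ) : thetaCoeff u v 0 τ = 12
  zero_coeff_two (τ : ℍ) : thetaCoeff u v 2 τ = 2 * EisensteinSeries.E2 τ
  negTwo_coeff_zero (τ : ℍ) : thetaCoeff u' v' 0 τ = 0
  negTwo_coeff_two (τ : ℍ) : thetaCoeff u' v' 2 τ = 2

variable {u v u' v' : ℍ → ℂ}

/-- The matrix of Taylor coefficients of orders 0 and 2 of the two forms has determinant 12 · 2 =
24, and it factors through the Wronskian. -/
theorem PhiDecomp.thetaWronskian_ne_zero (h : PhiDecomp u v u' v') (τ : ℍ) :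
    thetaWronskian τ ≠ 0 := fun hW => by
  have h1 := h.zero_coeff_zero τ
  have h2 := h.zero_coeff_two τ
  have h3 := h.negTwo_coeff_zero τ
  have h4 := h.negTwo_coeff_two τ
  have e : (u τ * v' τ - v τ * u' τ) * thetaWronskian τ =
      thetaCoeff u v 0 τ * thetaCoeff u' v' 2 τ - thetaCoeff u' v' 0 τ * thetaCoeff u v 2 τ := by
    simp only [thetaWronskian, thetaCoeff]
    ring
  rw [h1, h3, h4, hW] at e
  norm_num at e

/-- These limits are the q⁰ terms: p + 10 + p⁻¹ for φ_{0,1} and p - 2 + p⁻¹ for φ_{-2,1}. -/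
theorem PhiDecomp.tendsto (h : PhiDecomp u v u' v') :
    Tendsto u UpperHalfPlane.atImInfty (𝓝 10) ∧ Tendsto v UpperHalfPlane.atImInfty (𝓝 1) ∧
      Tendsto u' UpperHalfPlane.atImInfty (𝓝 (-2)) ∧
      Tendsto v' UpperHalfPlane.atImInfty (𝓝 1) := by
  have h1 := tendsto_of_tendsto_thetaCoeff (u := u) (v := v) (a := 12) (b := 2)
    (by rw [funext h.zero_coeff_zero]; exact tendsto_const_nhds)
    (by rw [funext h.zero_coeff_two]; simpa using tendsto_E2.const_mul 2)
  have h2 := tendsto_of_tendsto_thetaCoeff (u := u') (v := v') (a := 0) (b := 2)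
    (by rw [funext h.negTwo_coeff_zero]; exact tendsto_const_nhds)
    (by rw [funext h.negTwo_coeff_two]; exact tendsto_const_nhds)
  norm_num at h1 h2
  exact ⟨h1.1, h1.2, h2.1, h2.2⟩

/-- The order 4 coefficient has weight -2 + 4 = 2. As the order 0 coefficient vanishes, its only
anomaly is 24τ/(2πi), that of 2 E₂. -/
theorem PhiDecomp.negTwo_coeff_four (h : PhiDecomp u v u' v') (τ : ℍ) :
    thetaCoeff u' v' 4 τ = 2 * EisensteinSeries.E2 τ := by
  have hw : IsWeaklyModular 2
      (fun τ => thetaCoeff u' v' 4 τ - 2 * EisensteinSeries.E2 τ) := by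
    refine ⟨(h.decompNegTwo.mdifferentiable_thetaCoeff 4).sub
      ((isWeaklyModular_const 2).mdifferentiable.mul E2_mdifferentiable), fun τ => ?_, fun τ => ?_⟩
    · rw [h.decompNegTwo.thetaCoeff_T, E2_T_smul]
    · rw [(h.decompNegTwo.thetaCoeff_S hasJacobiS_phiNegTwo τ).2.2, h.negTwo_coeff_two,
        h.negTwo_coeff_zero, E2_S_smul]
      have := τ.ne_zero
      have := Complex.two_pi_I_ne_zero
      have hpi : (π : ℂ) ≠ 0 := by exact_mod_cast Real.pi_ne_zero
      rw [zpow_neg]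
      norm_cast
      field_simp
      ring
  refine sub_eq_zero.1 (hw.eq_zero (by norm_num) ?_ τ)
  have := (tendsto_thetaCoeff h.tendsto.2.2.1 h.tendsto.2.2.2 4).sub (tendsto_E2.const_mul 2)
  norm_num at this
  exact this

/-! ### The identity `φ_{0,1} = 12 φ_{-2,1} ℘` -/

theorem iteratedDeriv_of_chain {s : ℂ} {H : ℕ → ℂ → ℂ}
    (hH : ∀ j z, HasDerivAt (H j) (s * H (j + 1) z) z) (n : ℕ) :
    iteratedDeriv n (H 0) = fun z => s ^ n * H n z := by
  induction n with
  | zero => simp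
  | succ n ih =>
    ext z
    rw [iteratedDeriv_succ, ih, ((hH n z).const_mul (s ^ n)).deriv]
    ring

/-- Taylor coefficients are expressed as limits in a punctured neighbourhood because φ_{-2,1} ℘ is
given by its formula only there. -/
theorem tendsto_taylor_of_chain {s : ℂ} {H : ℕ → ℂ → ℂ}
    (hH : ∀ j z, HasDerivAt (H j) (s * H (j + 1) z) z) (n : ℕ) :
    Tendsto (fun z => (H 0 z - ∑ j ∈ Finset.range n, s ^ j * H j 0 / j.factorial * z ^ j) / z ^ n)
      (𝓝[≠] 0) (𝓝 (s ^ n * H n 0 / n.factorial)) := by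
  have hd : Differentiable ℂ (H 0) := fun z => (hH 0 z).differentiableAt
  have hO := (hd.analyticAt 0).hasFPowerSeriesAt.isBigO_sub_partialSum_pow (n + 1)
  simp only [FormalMultilinearSeries.partialSum, zero_add, iteratedDeriv_of_chain hH,
    FormalMultilinearSeries.ofScalars_apply_eq, smul_eq_mul] at hO
  obtain ⟨C, hC⟩ := hO.bound
  refine tendsto_iff_norm_sub_tendsto_zero.2 (squeeze_zero' (Eventually.of_forall fun _ =>
    norm_nonneg _) (g := fun z => C * ‖z‖) ?_ ?_)
  · filter_upwards [nhdsWithin_le_nhds hC, self_mem_nhdsWithin] with z hz hz0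
    have hz0' : z ≠ 0 := hz0
    have e : (H 0 z - ∑ j ∈ Finset.range n, s ^ j * H j 0 / j.factorial * z ^ j) / z ^ n -
        s ^ n * H n 0 / n.factorial =
        (H 0 z - ∑ j ∈ Finset.range (n + 1), s ^ j * H j 0 / j.factorial * z ^ j) / z ^ n := by
      rw [Finset.sum_range_succ]
      field_simp
      ring
    rw [e, norm_div, norm_pow, div_le_iff₀ (pow_pos (norm_pos_iff.2 hz0') n)]
    refine hz.trans_eq ?_
    rw [norm_pow, norm_norm, pow_succ]
    ring
  · have : Tendsto (fun z : ℂ => C * ‖z‖) (𝓝 0) (𝓝 (C * ‖(0 : ℂ)‖)) :=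
      (continuous_const.mul continuous_norm).tendsto 0
    simpa using this.mono_left nhdsWithin_le_nhds

/-- Riemann's removable singularity theorem, applied at each point of the discrete set L. -/
theorem exists_differentiable_extension {h : ℂ → ℂ} {L : Set ℂ} (hLc : IsClosed L)
    (hL : ∀ z, Lᶜ ∈ 𝓝[≠] z) (hd : DifferentiableOn ℂ h Lᶜ)
    (ht : ∀ z ∈ L, ∃ c, Tendsto h (𝓝[≠] z) (𝓝 c)) :
    ∃ P : ℂ → ℂ, Differentiable ℂ P ∧ ∀ z ∉ L, P z = h z := by
  classical
  refine ⟨fun z => if z ∈ L then limUnder (𝓝[≠] z) h else h z, fun z => ?_,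
    fun z hz => if_neg hz⟩
  by_cases hz : z ∈ L
  · obtain ⟨s, hs, hs'⟩ := mem_nhdsWithin_iff_exists_mem_nhds_inter.1 (hL z)
    obtain ⟨c, hc⟩ := ht z hz
    have ho : (fun w => h w - h z) =o[𝓝[≠] z] fun w => (w - z)⁻¹ := by
      have h1 : (fun w => h w - h z) =O[𝓝[≠] z] fun _ => (1 : ℂ) :=
        (hc.sub_const (h z)).isBigO_one ℂ
      refine h1.trans_isLittleO ?_
      refine Asymptotics.isLittleO_of_tendsto' ?_ ?_
      · filter_upwards [self_mem_nhdsWithin] with w hw h0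
        exact absurd (sub_eq_zero.1 (inv_eq_zero.1 h0)) hw
      · have : Tendsto (fun w : ℂ => w - z) (𝓝[≠] z) (𝓝 (z - z)) :=
          ((continuous_id.sub continuous_const).tendsto z).mono_left nhdsWithin_le_nhds
        simpa using this
    have hu := Complex.differentiableOn_update_limUnder_of_isLittleO hs
      (hd.mono fun w hw => hs' ⟨hw.1, hw.2⟩) ho
    refine (hu.differentiableAt hs).congr_of_eventuallyEq ?_
    filter_upwards [hs] with w hw
    by_cases hwz : w = z
    · subst hwz
      simp [hz]
    · have : w ∉ L := hs' ⟨hw, hwz⟩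
      simp [this, Function.update_of_ne hwz]
  · have ho : Lᶜ ∈ 𝓝 z := hLc.isOpen_compl.mem_nhds hz
    refine (hd.differentiableAt ho).congr_of_eventuallyEq ?_
    filter_upwards [ho] with w hw
    exact if_neg hw

theorem eq_of_eq_off {L : Set ℂ} (hL : ∀ z, Lᶜ ∈ 𝓝[≠] z) {f g : ℂ → ℂ} (hf : Continuous f)
    (hg : Continuous g) (h : ∀ z ∉ L, f z = g z) (z : ℂ) : f z = g z := by
  have h1 := (hf.tendsto z).mono_left (nhdsWithin_le_nhds (s := {z}ᶜ))
  have h2 := (hg.tendsto z).mono_left (nhdsWithin_le_nhds (s := {z}ᶜ))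
  refine tendsto_nhds_unique (h1.congr' ?_) h2
  filter_upwards [hL z] with w hw using h w hw

/-- The quasi-periodicity of theta functions of index one under the full lattice. -/
theorem add_lattice_of_quasiperiodic {τ : ℂ} {f : ℂ → ℂ} (h1 : ∀ z, f (z + 1) = f z)
    (h2 : ∀ z, f (z + τ) = Complex.exp (2 * π * Complex.I * (-τ - 2 * z)) * f z)
    (l m : ℤ) (z : ℂ) : f (z + l * τ + m) =
      Complex.exp (-(2 * π * Complex.I * ((l : ℂ) ^ 2 * τ + 2 * l * z))) * f z := by
  have hm (m : ℤ) (z : ℂ) : f (z + m) = f z := by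
    have := (show Function.Periodic f 1 from h1).int_mul m z
    simpa using this
  rw [hm]
  induction l with
  | zero => simp
  | succ n ih =>
    push_cast at ih ⊢
    rw [show z + ((n : ℂ) + 1) * τ = z + n * τ + τ by ring, h2, ih, ← mul_assoc,
      ← Complex.exp_add]
    congr 2
    ring
  | pred n ih =>
    push_cast at ih ⊢
    have := h2 (z + (-(n : ℂ) - 1) * τ)
    rw [show z + (-(n : ℂ) - 1) * τ + τ = z + -n * τ by ring, ih] at this
    rw [← mul_right_inj' (Complex.exp_ne_zero (2 * π * Complex.I *
      (-τ - 2 * (z + (-(n : ℂ) - 1) * τ)))), ← this, ← mul_assoc, ← Complex.exp_add]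
    congr 2
    ring

/-! ### The period lattice, ℘, and the product φ_{-2,1} ℘. -/

theorem compl_lattice_mem (L : PeriodPair) (z : ℂ) : (L.lattice : Set ℂ)ᶜ ∈ 𝓝[≠] z := by
  have h := L.compl_lattice_sdiff_singleton_mem_nhds z
  filter_upwards [nhdsWithin_le_nhds h, self_mem_nhdsWithin] with w hw hz hL
  exact hw ⟨hL, hz⟩

theorem mem_lattice_periods {τ : ℍ} {z : ℂ} :
    z ∈ (periods τ).lattice ↔ ∃ l m : ℤ, z = l * τ + m := by
  rw [PeriodPair.mem_lattice]
  constructor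
  · rintro ⟨m, l, h⟩
    exact ⟨l, m, by rw [← h]; simp [periods, add_comm]⟩
  · rintro ⟨l, m, h⟩
    exact ⟨m, l, by rw [h]; simp [periods, add_comm]⟩

theorem wp_add (τ : ℍ) {w : ℂ} (hw : w ∈ (periods τ).lattice) (z : ℂ) :
    wp (z + w) τ = wp z τ := by
  rw [wp, wp, (periods τ).weierstrassP_add_coe z ⟨w, hw⟩]

theorem HasThetaDecomp.differentiable {F : ℂ → ℍ → ℂ} {a b : ℍ → ℂ} (hF : HasThetaDecomp F a b)
    (τ : ℍ) : Differentiable ℂ (fun z => F z τ) := fun z => by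
  simp only [hF.eq]
  exact (hasDerivAt_thetaComb (a τ) (b τ) 0 τ z).differentiableAt

theorem HasThetaDecomp.add_one {F : ℂ → ℍ → ℂ} {a b : ℍ → ℂ} (hF : HasThetaDecomp F a b)
    (z : ℂ) (τ : ℍ) : F (z + 1) τ = F z τ := by
  rw [hF.eq, hF.eq, theta_add_one, theta_add_one]

theorem HasThetaDecomp.add_tau {F : ℂ → ℍ → ℂ} {a b : ℍ → ℂ} (hF : HasThetaDecomp F a b)
    (z : ℂ) (τ : ℍ) :
    F (z + τ) τ = Complex.exp (2 * π * Complex.I * (-τ - 2 * z)) * F z τ := by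
  rw [hF.eq, hF.eq, theta_add_tau, theta_add_tau]
  ring

theorem HasThetaDecomp.add_lattice {F : ℂ → ℍ → ℂ} {a b : ℍ → ℂ} (hF : HasThetaDecomp F a b)
    (z : ℂ) (τ : ℍ) (l m : ℤ) : F (z + l * τ + m) τ =
      Complex.exp (-(2 * π * Complex.I * ((l : ℂ) ^ 2 * τ + 2 * l * z))) * F z τ :=
  add_lattice_of_quasiperiodic (f := fun z => F z τ) (fun z => hF.add_one z τ)
    (fun z => hF.add_tau z τ) l m z

theorem thetaComb_of_odd (a b : ℂ) {j : ℕ} (hj : Odd j) (τ : ℂ) :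
    a * theta 0 j 0 τ + b * theta 1 j 0 τ = 0 := by
  rw [theta_zero_of_odd 0 hj, theta_zero_of_odd 1 hj]
  ring

theorem PhiDecomp.tendsto_negTwo_two (h : PhiDecomp u v u' v') (τ : ℍ) :
    Tendsto (fun z => phiNegTwo z τ / z ^ 2) (𝓝[≠] 0) (𝓝 ((2 * π * Complex.I) ^ 2)) := by
  have h0 := h.negTwo_coeff_zero τ
  have h2 := h.negTwo_coeff_two τ
  rw [thetaCoeff] at h0 h2
  have := tendsto_taylor_of_chain (fun j z => hasDerivAt_thetaComb (u' τ) (v' τ) j τ z) 2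
  simp only [Finset.sum_range_succ, Finset.sum_range_zero, h0, h2, thetaComb_of_odd _ _ odd_one,
    ← h.decompNegTwo.eq] at this
  simpa using this

theorem PhiDecomp.tendsto_negTwo_four (h : PhiDecomp u v u' v') (τ : ℍ) :
    Tendsto (fun z => (phiNegTwo z τ - (2 * π * Complex.I) ^ 2 * z ^ 2) / z ^ 4) (𝓝[≠] 0)
      (𝓝 ((2 * π * Complex.I) ^ 4 * EisensteinSeries.E2 τ / 12)) := by
  have h0 := h.negTwo_coeff_zero τ
  have h2 := h.negTwo_coeff_two τ
  have h4 := h.negTwo_coeff_four τ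
  rw [thetaCoeff] at h0 h2 h4
  have := tendsto_taylor_of_chain (fun j z => hasDerivAt_thetaComb (u' τ) (v' τ) j τ z) 4
  simp only [Finset.sum_range_succ, Finset.sum_range_zero, h0, h2, h4,
    thetaComb_of_odd _ _ odd_one, thetaComb_of_odd _ _ (show Odd 3 by decide),
    ← h.decompNegTwo.eq] at this
  convert this using 2 with z
  · simp
  · have (x y : ℂ) : x ^ 4 * y / 12 = x ^ 4 * (2 * y) / (Nat.factorial 4 : ℕ) := by
      simp only [Nat.factorial]
      push_cast
      ring
    exact this _ _

theorem PhiDecomp.tendsto_zero_two (h : PhiDecomp u v u' v') (τ : ℍ) :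
    Tendsto (fun z => (phiZero z τ - 12) / z ^ 2) (𝓝[≠] 0)
      (𝓝 ((2 * π * Complex.I) ^ 2 * EisensteinSeries.E2 τ)) := by
  have h0 := h.zero_coeff_zero τ
  have h2 := h.zero_coeff_two τ
  rw [thetaCoeff] at h0 h2
  have := tendsto_taylor_of_chain (fun j z => hasDerivAt_thetaComb (u τ) (v τ) j τ z) 2
  simp only [Finset.sum_range_succ, Finset.sum_range_zero, h0, h2, thetaComb_of_odd _ _ odd_one,
    ← h.decompZero.eq] at this
  convert this using 2 with z
  · simp
  · have (x y : ℂ) : x ^ 2 * y = x ^ 2 * (2 * y) / (Nat.factorial 2 : ℕ) := by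
      simp only [Nat.factorial]
      push_cast
      ring
    exact this _ _

theorem wp_eq (τ : ℍ) (z : ℂ) : wp z τ = (2 * π * Complex.I) ^ (-2 : ℤ) *
    (1 / z ^ 2 + (periods τ).weierstrassPExcept 0 z) := by
  have := (periods τ).weierstrassPExcept_add 0 z
  rw [wp, ← this]
  simp [add_comm]

theorem tendsto_weierstrassPExcept_zero (τ : ℍ) :
    Tendsto ((periods τ).weierstrassPExcept 0) (𝓝[≠] 0) (𝓝 0) := by
  have h := ((periods τ).differentiableOn_weierstrassPExcept 0).differentiableAt
    ((periods τ).compl_lattice_sdiff_singleton_mem_nhds 0)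
  simpa using h.continuousAt.tendsto.mono_left nhdsWithin_le_nhds

/-- The double zero of φ_{-2,1} cancels the double pole of ℘, with leading coefficients (2πi)² and
(2πi)⁻². -/
theorem PhiDecomp.tendsto_mul_wp (h : PhiDecomp u v u' v') (τ : ℍ) :
    Tendsto (fun z => phiNegTwo z τ * wp z τ) (𝓝[≠] 0) (𝓝 1) := by
  have hz : Tendsto (fun z : ℂ => z ^ 2) (𝓝[≠] 0) (𝓝 0) := by
    have : Tendsto (fun z : ℂ => z ^ 2) (𝓝 0) (𝓝 (0 ^ 2)) := (continuous_pow 2).tendsto 0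
    simpa using this.mono_left nhdsWithin_le_nhds
  have := ((h.tendsto_negTwo_two τ).const_mul ((2 * π * Complex.I) ^ (-2 : ℤ))).mul
    ((hz.mul (tendsto_weierstrassPExcept_zero τ)).const_add 1)
  have hs := Complex.two_pi_I_ne_zero
  rw [zpow_neg, zpow_ofNat, inv_mul_cancel₀ (pow_ne_zero 2 hs)] at this
  simp only [mul_zero, add_zero, mul_one] at this
  refine this.congr' ?_
  filter_upwards [self_mem_nhdsWithin] with z hz
  have hz' : z ≠ 0 := hz
  rw [wp_eq τ, zpow_neg, zpow_ofNat]
  field_simp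

/-- The limit at 0 is carried to every lattice point by the quasi-periodicity of φ_{-2,1} and the
periodicity of ℘. -/
theorem PhiDecomp.exists_extension (h : PhiDecomp u v u' v') (τ : ℍ) :
    ∃ P : ℂ → ℂ, Differentiable ℂ P ∧
      ∀ z ∉ (periods τ).lattice, P z = phiNegTwo z τ * wp z τ := by
  refine exists_differentiable_extension (periods τ).isClosed_lattice
    (compl_lattice_mem _) ((h.decompNegTwo.differentiable τ).differentiableOn.mul
      ((periods τ).differentiableOn_weierstrassP.const_mul _)) fun z hz => ?_
  obtain ⟨l, m, rfl⟩ := mem_lattice_periods.1 hz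
  have ht : Tendsto (fun w : ℂ => w - (l * τ + m)) (𝓝[≠] (l * τ + m)) (𝓝[≠] 0) := by
    refine tendsto_nhdsWithin_iff.2 ⟨?_, ?_⟩
    · have : Tendsto (fun w : ℂ => w - (l * τ + m)) (𝓝 (l * τ + m)) (𝓝 (l * τ + m - (l * τ + m))) :=
        (continuous_id.sub continuous_const).tendsto _
      rw [sub_self] at this
      exact this.mono_left nhdsWithin_le_nhds
    · filter_upwards [self_mem_nhdsWithin] with w hw using sub_ne_zero.2 hw
  have he : Tendsto (fun w : ℂ => Complex.exp (-(2 * π * Complex.I *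
      ((l : ℂ) ^ 2 * τ + 2 * l * (w - (l * τ + m)))))) (𝓝[≠] (l * τ + m))
      (𝓝 (Complex.exp (-(2 * π * Complex.I *
      ((l : ℂ) ^ 2 * τ + 2 * l * ((l * τ + m) - (l * τ + m))))))) := by
    have : Continuous (fun w : ℂ => Complex.exp (-(2 * π * Complex.I *
      ((l : ℂ) ^ 2 * τ + 2 * l * (w - (l * τ + m)))))) := by fun_prop
    exact (this.tendsto _).mono_left nhdsWithin_le_nhds
  refine ⟨_, (he.mul ((h.tendsto_mul_wp τ).comp ht)).congr fun w => ?_⟩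
  have h1 := h.decompNegTwo.add_lattice (w - (l * τ + m)) τ l m
  have h2 := wp_add τ hz (w - (l * τ + m))
  rw [sub_add_cancel] at h2
  rw [show w - (l * τ + m) + l * τ + m = w by ring] at h1
  simp only [Function.comp]
  rw [h1, h2]
  ring

/-- The extension P of φ_{-2,1} ℘ is again a theta function of index 1. The coefficients of orders 0
and 2 of φ_{0,1} - 12 P vanish, and the nonzero Wronskian then makes both theta coordinates vanish.
-/
theorem PhiDecomp.phiZero_eq_mul_wp (h : PhiDecomp u v u' v') (τ : ℍ) {z : ℂ}
    (hz : z ∉ (periods τ).lattice) : phiZero z τ = 12 * (phiNegTwo z τ * wp z τ) := by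
  obtain ⟨P, hP, hPe⟩ := h.exists_extension τ
  have hL := compl_lattice_mem (periods τ)
  have hω₁ : (1 : ℂ) ∈ (periods τ).lattice := (periods τ).ω₁_mem_lattice
  have hω₂ : (τ : ℂ) ∈ (periods τ).lattice := (periods τ).ω₂_mem_lattice
  have hmem {w z : ℂ} (hw : w ∈ (periods τ).lattice) (hz : z ∉ (periods τ).lattice) :
      z + w ∉ (periods τ).lattice := fun h => hz (by simpa using sub_mem h hw)
  have hP1 : ∀ z, P (z + 1) = P z := eq_of_eq_off hL (hP.continuous.comp
    (continuous_id.add continuous_const)) hP.continuous fun z hz => by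
      have h1 : P (z + 1) = P z := by
        rw [hPe _ (hmem hω₁ hz), hPe z hz, wp_add τ hω₁, h.decompNegTwo.add_one]
      exact h1
  have hP2 : ∀ z, P (z + τ) = Complex.exp (2 * π * Complex.I * (-τ - 2 * z)) * P z :=
    eq_of_eq_off hL (hP.continuous.comp (continuous_id.add continuous_const))
      ((by fun_prop : Continuous fun z : ℂ =>
        Complex.exp (2 * π * Complex.I * (-τ - 2 * z))).mul hP.continuous) fun z hz => by
      have h1 : P (z + τ) = Complex.exp (2 * π * Complex.I * (-τ - 2 * z)) * P z := by
        rw [hPe _ (hmem hω₂ hz), hPe z hz, wp_add τ hω₂, h.decompNegTwo.add_tau, mul_assoc]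
      exact h1
  obtain ⟨a, b, hab⟩ := exists_eq_theta τ.2 hP hP1 hP2
  have hPw : ∀ᶠ z in 𝓝[≠] (0 : ℂ), P z = phiNegTwo z τ * wp z τ := by
    filter_upwards [hL 0] with z hz using hPe z hz
  have hP0 : P 0 = 1 := tendsto_nhds_unique
    ((hP.continuous.tendsto 0).mono_left (nhdsWithin_le_nhds (s := {0}ᶜ)))
    ((h.tendsto_mul_wp τ).congr' (hPw.mono fun z hz => hz.symm))
  have hG (z : ℂ) : (u τ - 12 * a) * theta 0 0 z τ + (v τ - 12 * b) * theta 1 0 z τ =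
      phiZero z τ - 12 * P z := by
    rw [h.decompZero.eq, hab]
    ring
  have hG0 : (u τ - 12 * a) * theta 0 0 0 τ + (v τ - 12 * b) * theta 1 0 0 τ = 0 := by
    rw [hG, h.decompZero.eq, hP0]
    have := h.zero_coeff_zero τ
    rw [thetaCoeff] at this
    rw [this]
    norm_num
  have hs := Complex.two_pi_I_ne_zero
  have hG2 : (u τ - 12 * a) * theta 0 2 0 τ + (v τ - 12 * b) * theta 1 2 0 τ = 0 := by
    have h1 := tendsto_taylor_of_chain
      (fun j z => hasDerivAt_thetaComb (u τ - 12 * a) (v τ - 12 * b) j τ z) 2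
    simp only [Finset.sum_range_succ, Finset.sum_range_zero, hG0, thetaComb_of_odd _ _ odd_one,
      hG] at h1
    -- Divided by z², the difference splits into the remainder of φ_{0,1}, that of φ_{-2,1}, and the
    -- regular part of ℘ times φ_{-2,1} / z²; the 12 / z² terms cancel.
    have h2 := ((h.tendsto_zero_two τ).sub (((h.tendsto_negTwo_four τ).const_mul 12).div_const
      ((2 * π * Complex.I) ^ 2))).sub (((h.tendsto_negTwo_two τ).mul
      (tendsto_weierstrassPExcept_zero τ)).const_mul (12 / (2 * π * Complex.I) ^ 2))
    have e : (2 * π * Complex.I) ^ 2 * EisensteinSeries.E2 τ - 12 * ((2 * π * Complex.I) ^ 4 *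
        EisensteinSeries.E2 τ / 12) / (2 * π * Complex.I) ^ 2 - 12 / (2 * π * Complex.I) ^ 2 *
        ((2 * π * Complex.I) ^ 2 * 0) = (0 : ℂ) := by
      field_simp
      ring
    rw [e] at h2
    have h3 := tendsto_nhds_unique h1 (h2.congr' (by
      filter_upwards [hPw, self_mem_nhdsWithin] with z hz hz0
      have hz0' : z ≠ 0 := hz0
      rw [hz, wp_eq τ, zpow_neg, zpow_ofNat]
      generalize 2 * (π : ℂ) * Complex.I = s at hs
      field_simp
      ring))
    rw [div_eq_zero_iff, mul_eq_zero] at h3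
    rcases h3 with (h3 | h3) | h3
    · exact absurd h3 (pow_ne_zero 2 hs)
    · exact h3
    · norm_num at h3
  have hW := h.thetaWronskian_ne_zero τ
  have hu : u τ - 12 * a = 0 := by
    refine (mul_eq_zero.1 ?_).resolve_right hW
    rw [thetaWronskian]
    linear_combination theta 1 2 0 τ * hG0 - theta 1 0 0 τ * hG2
  have hv : v τ - 12 * b = 0 := by
    refine (mul_eq_zero.1 ?_).resolve_right hW
    rw [thetaWronskian]
    linear_combination theta 0 0 0 τ * hG2 - theta 0 2 0 τ * hG0
  have := hG z
  rw [hu, hv, hPe z hz] at this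
  linear_combination -this

/-! ### Fourier expansions -/

theorem exists_hasSum_qExpansion {f : ℍ → ℂ} {a : ℂ} (hf : MDiff f)
    (hT : ∀ τ, f (ModularGroup.T • τ) = f τ) (ha : Tendsto f UpperHalfPlane.atImInfty (𝓝 a)) :
    ∃ c : ℕ → ℂ, c 0 = a ∧
      ∀ τ : ℍ, HasSum (fun m => c m * Complex.exp (2 * π * Complex.I * τ) ^ m) (f τ) := by
  have hper : Function.Periodic (f ∘ UpperHalfPlane.ofComplex) ((1 : ℝ) : ℂ) := fun w => by
    by_cases hw : 0 < w.im
    · have hw' : 0 < (w + (1 : ℝ)).im := by simpa using hw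
      simp only [Function.comp_apply, UpperHalfPlane.ofComplex_apply_of_im_pos hw,
        UpperHalfPlane.ofComplex_apply_of_im_pos hw']
      rw [← hT ⟨w, hw⟩]
      congr 1
      ext
      rw [coe_T_smul]
      simp
    · have hw' : ¬ 0 < (w + (1 : ℝ)).im := by simpa using hw
      simp [UpperHalfPlane.ofComplex_apply_eq_of_im_nonpos (not_lt.1 hw) (not_lt.1 hw')]
  have hbdd : UpperHalfPlane.IsBoundedAtImInfty f := ha.isBigO_one ℝ
  have hs := fun τ : ℍ => UpperHalfPlane.hasSum_qExpansion one_pos hper hf hbdd τ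
  refine ⟨_, tendsto_nhds_unique (tendsto_of_hasSum_qExpansion hs) ha, fun τ => ?_⟩
  have := hs τ
  simp only [Function.Periodic.qParam, smul_eq_mul, Complex.ofReal_one, div_one] at this
  exact this

/-- The exponent of `q` in the `n`-th term of the theta function with parity `ε`. -/
def thetaExponent (ε : ℕ) (n : ℤ) : ℕ := (n ^ 2 + ε * n).toNat

theorem coe_thetaExponent {ε : ℕ} (hε : ε ≤ 1) (n : ℤ) :
    (thetaExponent ε n : ℤ) = n ^ 2 + ε * n := by
  refine Int.toNat_of_nonneg ?_
  interval_cases ε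
  · simpa using sq_nonneg n
  · rcases le_or_gt 0 n with h | h
    · positivity
    · push_cast
      nlinarith

/-- The Fourier coefficients of `(∑ a m q ^ m) θ_ε`. -/
def thetaFourier (ε : ℕ) (a : ℕ → ℂ) (n : ℕ) (r : ℤ) : ℂ :=
  if r = 2 * (r / 2) + ε ∧ thetaExponent ε (r / 2) ≤ n then a (n - thetaExponent ε (r / 2)) else 0

/-- The exponents of `q` and `p` in the product of `q ^ m` and the `n`-th term of the theta
function with parity `ε`. -/
def thetaIndex (ε : ℕ) (x : ℕ × ℤ) : ℕ × ℤ := (x.1 + thetaExponent ε x.2, 2 * x.2 + ε)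

theorem thetaIndex_injective (ε : ℕ) : Function.Injective (thetaIndex ε) := by
  rintro ⟨m, n⟩ ⟨m', n'⟩ h
  simp only [thetaIndex, Prod.mk.injEq] at h
  obtain rfl : n = n' := by omega
  simpa using h.1

theorem thetaFourier_eq_zero_of_notMem {ε : ℕ} (a : ℕ → ℂ) {x : ℕ × ℤ}
    (hx : x ∉ Set.range (thetaIndex ε)) : thetaFourier ε a x.1 x.2 = 0 := by
  obtain ⟨N, r⟩ := x
  refine if_neg fun h => hx ⟨(N - thetaExponent ε (r / 2), r / 2), ?_⟩
  simp only [thetaIndex, Prod.mk.injEq]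
  exact ⟨Nat.sub_add_cancel h.2, h.1.symm⟩

theorem thetaFourier_thetaIndex {ε : ℕ} (hε : ε ≤ 1) (a : ℕ → ℂ) (m : ℕ) (n : ℤ) :
    thetaFourier ε a (m + thetaExponent ε n) (2 * n + ε) = a m := by
  have hdiv : (2 * n + ε) / 2 = n := by omega
  rw [thetaFourier, hdiv, if_pos ⟨rfl, Nat.le_add_left _ _⟩, Nat.add_sub_cancel]

theorem thetaTerm_eq_zpow_mul {ε : ℕ} (hε : ε ≤ 1) (n : ℤ) (z τ : ℂ) :
    thetaTerm ε 0 n z τ = Complex.exp (2 * π * Complex.I * z) ^ (2 * n + (ε : ℤ)) *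
      Complex.exp (2 * π * Complex.I * τ) ^ thetaExponent ε n := by
  have hx : ((thetaExponent ε n : ℕ) : ℂ) = (n : ℂ) ^ 2 + ε * n := by
    exact_mod_cast congrArg (Int.cast : ℤ → ℂ) (coe_thetaExponent hε n)
  rw [thetaTerm, ← Complex.exp_int_mul, ← Complex.exp_nat_mul, ← Complex.exp_add, hx, pow_zero,
    one_mul]
  congr 1
  push_cast
  ring

theorem hasSum_mul_prod {f : ℕ → ℂ} {g : ℤ → ℂ} {a b : ℂ} (hf : HasSum f a) (hg : HasSum g b) :
    HasSum (fun x : ℕ × ℤ => f x.1 * g x.2) (a * b) :=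
  hf.mul hg (summable_mul_of_summable_norm hf.summable.norm hg.summable.norm)

/-- Each pair (n, r) arises from at most one pair of indices, so the product series is a relabelling
of the Fourier series and no terms need to be collected. -/
theorem hasSum_thetaFourier {ε : ℕ} (hε : ε ≤ 1) {a : ℕ → ℂ} {A : ℂ} {τ : ℂ} (hτ : 0 < τ.im)
    (hA : HasSum (fun m => a m * Complex.exp (2 * π * Complex.I * τ) ^ m) A) (z : ℂ) :
    HasSum (fun x : ℕ × ℤ => thetaFourier ε a x.1 x.2 *
      Complex.exp (2 * π * Complex.I * z) ^ x.2 * Complex.exp (2 * π * Complex.I * τ) ^ x.1)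
      (A * theta ε 0 z τ) := by
  have hs := summable_thetaTerm hε 0 z hτ
  have ht : HasSum (fun n => thetaTerm ε 0 n z τ) (theta ε 0 z τ) := hs.hasSum
  generalize theta ε 0 z τ = t at ht ⊢
  have hm := hasSum_mul_prod hA ht
  rw [← (thetaIndex_injective ε).hasSum_iff fun x hx => by
    rw [thetaFourier_eq_zero_of_notMem a hx, zero_mul, zero_mul]]
  refine (congrArg (fun f : ℕ × ℤ → ℂ => HasSum f (A * t)) (funext fun x => ?_)).mp hm
  simp only [Function.comp_apply, thetaIndex]
  rw [thetaFourier_thetaIndex hε, thetaTerm_eq_zpow_mul hε, pow_add]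
  ring

/-- A nonzero entry has r = 2k + ε and n ≥ k² + εk, so r² ≤ 4n + ε. For ε = 1, r² > 4n forces n = k²
+ k, and the entry is the constant term a(0). -/
theorem thetaFourier_eq_zero {ε : ℕ} (hε : ε ≤ 1) {a : ℕ → ℂ} (ha : ε = 1 → a 0 = 0) {n : ℕ}
    {r : ℤ} (h : 4 * (n : ℤ) < r ^ 2) : thetaFourier ε a n r = 0 := by
  rw [thetaFourier]
  split_ifs with h1
  · obtain ⟨h1, h2⟩ := h1
    have h3 := coe_thetaExponent hε (r / 2)
    zify at h2
    generalize r / 2 = k at *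
    rw [h1] at h
    interval_cases ε
    · push_cast at h h3
      nlinarith
    · push_cast at h h3
      have : (n : ℤ) ≤ thetaExponent 1 k := by nlinarith
      rw [Nat.sub_eq_zero_of_le (by exact_mod_cast this)]
      exact ha rfl
  · rfl

/-! ### The function `E_{2,1}` -/

theorem PhiDecomp.preE21_eq (h : PhiDecomp u v u' v') (τ : ℍ) {z : ℂ}
    (hz : z ∉ (periods τ).lattice) : preE21 z τ = EisensteinSeries.E2 τ / 12 * phiZero z τ +
      -ModularForm.E₄ τ / 12 * phiNegTwo z τ := by
  rw [h.phiZero_eq_mul_wp τ hz, preE21]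
  ring

theorem PhiDecomp.tendsto_preE21 (h : PhiDecomp u v u' v') (z : ℂ) (τ : ℍ) :
    Tendsto (fun w => preE21 w τ) (𝓝[≠] z) (𝓝 (EisensteinSeries.E2 τ / 12 * phiZero z τ +
      -ModularForm.E₄ τ / 12 * phiNegTwo z τ)) := by
  have hc : Continuous (fun z => EisensteinSeries.E2 τ / 12 * phiZero z τ +
      -ModularForm.E₄ τ / 12 * phiNegTwo z τ) :=
    (continuous_const.mul (h.decompZero.differentiable τ).continuous).add
      (continuous_const.mul (h.decompNegTwo.differentiable τ).continuous)
  refine ((hc.tendsto z).mono_left nhdsWithin_le_nhds).congr' ?_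
  filter_upwards [compl_lattice_mem (periods τ) z] with w hw using (h.preE21_eq τ hw).symm

/-- The right-hand side is continuous in z and agrees with the defining formula off the lattice, so
it also gives the limits at lattice points. -/
theorem PhiDecomp.E21_eq (h : PhiDecomp u v u' v') : E21 = fun z τ =>
    EisensteinSeries.E2 τ / 12 * phiZero z τ + -ModularForm.E₄ τ / 12 * phiNegTwo z τ := by
  ext z τ
  rw [E21]
  split_ifs with hz
  · exact (h.tendsto_preE21 z τ).limUnder_eq
  · exact h.preE21_eq τ hz

theorem PhiDecomp.hasThetaDecomp_E21 (h : PhiDecomp u v u' v') : HasThetaDecomp E21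
    (fun τ => EisensteinSeries.E2 τ / 12 * u τ + -ModularForm.E₄ τ / 12 * u' τ)
    (fun τ => EisensteinSeries.E2 τ / 12 * v τ + -ModularForm.E₄ τ / 12 * v' τ) := by
  have w4 := isWeaklyModular_modularForm ModularForm.E₄
  rw [h.E21_eq]
  refine h.decompZero.add h.decompNegTwo ?_ ?_ (fun τ => ?_) (fun τ => ?_)
  · exact UpperHalfPlane.mdifferentiable_iff.2
      ((UpperHalfPlane.mdifferentiable_iff.1 E2_mdifferentiable).div_const 12)
  · exact UpperHalfPlane.mdifferentiable_iff.2
      ((UpperHalfPlane.mdifferentiable_iff.1 w4.mdifferentiable).neg.div_const 12)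
  · rw [E2_T_smul]
  · rw [w4.T_smul]

theorem HasThetaDecomp.differentiableOn {F : ℂ → ℍ → ℂ} {a b : ℍ → ℂ}
    (hF : HasThetaDecomp F a b) :
    DifferentiableOn ℂ (fun x : ℂ × ℂ => F x.1 (UpperHalfPlane.ofComplex x.2))
      {x : ℂ × ℂ | 0 < x.2.im} := by
  have hc {w : ℍ → ℂ} (hw : MDiff w) {x : ℂ × ℂ} (hx : 0 < x.2.im) :
      DifferentiableAt ℂ (fun x : ℂ × ℂ => w (UpperHalfPlane.ofComplex x.2)) x :=
    ((UpperHalfPlane.mdifferentiable_iff.1 hw).differentiableAt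
      (UpperHalfPlane.isOpen_upperHalfPlaneSet.mem_nhds hx)).comp x differentiableAt_snd
  refine DifferentiableOn.congr (f := fun x : ℂ × ℂ =>
    a (UpperHalfPlane.ofComplex x.2) * theta 0 0 x.1 x.2 +
      b (UpperHalfPlane.ofComplex x.2) * theta 1 0 x.1 x.2) (fun x hx => ?_) fun x hx => ?_
  · exact (((hc hF.mdifferentiable_left hx).mul (differentiableAt_theta 0 hx)).add
      ((hc hF.mdifferentiable_right hx).mul
        (differentiableAt_theta 1 hx))).differentiableWithinAt
  · rw [hF.eq, UpperHalfPlane.ofComplex_apply_of_im_pos hx]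

theorem HasThetaDecomp.exists_hasSum {F : ℂ → ℍ → ℂ} {a b : ℍ → ℂ} {A : ℂ}
    (hF : HasThetaDecomp F a b) (ha : Tendsto a UpperHalfPlane.atImInfty (𝓝 A))
    (hb : Tendsto b UpperHalfPlane.atImInfty (𝓝 0)) :
    ∃ c : ℕ → ℤ → ℂ, (∀ (n : ℕ) (r : ℤ), 4 * (n : ℤ) < r ^ 2 → c n r = 0) ∧
      ∀ (z : ℂ) (τ : ℍ), HasSum (fun x : ℕ × ℤ => c x.1 x.2 *
        Complex.exp (2 * π * Complex.I * z) ^ x.2 *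
        Complex.exp (2 * π * Complex.I * (τ : ℂ)) ^ x.1) (F z τ) := by
  obtain ⟨c, -, hc⟩ := exists_hasSum_qExpansion hF.mdifferentiable_left hF.T_smul_left ha
  obtain ⟨d, hd0, hd⟩ := exists_hasSum_qExpansion hF.mdifferentiable_right hF.T_smul_right hb
  refine ⟨fun n r => thetaFourier 0 c n r + thetaFourier 1 d n r, fun n r h => ?_, fun z τ => ?_⟩
  · change thetaFourier 0 c n r + thetaFourier 1 d n r = 0
    rw [thetaFourier_eq_zero zero_le_one (by simp) h,
      thetaFourier_eq_zero le_rfl (fun _ => hd0) h, add_zero]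
  · rw [hF.eq]
    convert (hasSum_thetaFourier zero_le_one τ.2 (hc τ) z).add
      (hasSum_thetaFourier le_rfl τ.2 (hd τ) z) using 2
    ring

end JacobiE2

end

theorem lemma2p4 :
    -- the value at the poles of `℘` is a genuine limit
    (∀ (τ : UpperHalfPlane) (z : ℂ), Filter.Tendsto (fun u => JacobiE2.preE21 u τ)
      (nhdsWithin z {z}ᶜ) (nhds (JacobiE2.E21 z τ))) ∧
    -- holomorphic on `ℂ × ℍ`
    DifferentiableOn ℂ (fun x : ℂ × ℂ => JacobiE2.E21 x.1 (UpperHalfPlane.ofComplex x.2))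
      {x : ℂ × ℂ | 0 < x.2.im} ∧
    -- Fourier expansion in `q = exp (2 π i τ)` and `p = exp (2 π i z)`
    (∃ c : ℕ → ℤ → ℂ, (∀ (n : ℕ) (r : ℤ), 4 * (n : ℤ) < r ^ 2 → c n r = 0) ∧
      ∀ (z : ℂ) (τ : UpperHalfPlane),
        HasSum (fun x : ℕ × ℤ => c x.1 x.2 *
            Complex.exp (2 * Real.pi * Complex.I * z) ^ x.2 *
            Complex.exp (2 * Real.pi * Complex.I * (τ : ℂ)) ^ x.1)
          (JacobiE2.E21 z τ)) ∧
    -- elliptic transformation law of index `1`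
    (∀ (z : ℂ) (τ : UpperHalfPlane) (l m : ℤ),
      JacobiE2.E21 (z + l * τ + m) τ =
        Complex.exp (-(2 * Real.pi * Complex.I * ((l : ℂ) ^ 2 * τ + 2 * l * z))) *
          JacobiE2.E21 z τ) ∧
    -- modular transformation; `ModularGroup.S • τ = -1 / τ`
    (∀ (z : ℂ) (τ : UpperHalfPlane),
      JacobiE2.E21 (z / τ) (ModularGroup.S • τ) =
        Complex.exp (2 * Real.pi * Complex.I * z ^ 2 / τ) * (τ : ℂ) ^ 2 * JacobiE2.E21 z τ +
        1 / (2 * Real.pi * Complex.I) * Complex.exp (2 * Real.pi * Complex.I * z ^ 2 / τ) * τ *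
          JacobiE2.phiZero z τ) ∧
    -- restriction to `z = 0`
    (∀ τ : UpperHalfPlane, JacobiE2.E21 0 τ = EisensteinSeries.E2 τ) := by
  obtain ⟨u, v, u', v', h1, h2, h3, h4, h5, h6⟩ := JacobiE2.exists_phi_decomp
  have h : JacobiE2.PhiDecomp u v u' v' := ⟨h1, h2, h3, h4, h5, h6⟩
  have hE := h.hasThetaDecomp_E21
  have t4 : Filter.Tendsto ModularForm.E₄ UpperHalfPlane.atImInfty (nhds 1) :=
    JacobiE2.tendsto_eisenstein _ (by decide)
  have t2 := JacobiE2.tendsto_E2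
  obtain ⟨l1, l2, l3, l4⟩ := h.tendsto
  refine ⟨fun τ z => ?_, hE.differentiableOn, hE.exists_hasSum (A := 1) ?_ ?_, hE.add_lattice,
    fun z τ => ?_, fun τ => ?_⟩
  · rw [h.E21_eq]
    exact h.tendsto_preE21 z τ
  -- Constant term of the coefficient of θ₀: 10/12 + 2/12 = 1.
  · have := ((t2.div_const 12).mul l1).add ((t4.neg.div_const 12).mul l3)
    norm_num at this
    exact this
  -- Constant term of the coefficient of θ₁: 1/12 - 1/12 = 0, which removes the terms p^(±1) q⁰.
  · have := ((t2.div_const 12).mul l2).add ((t4.neg.div_const 12).mul l4)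
    norm_num at this
    exact this
  -- E₂ φ_{0,1} and E₄ φ_{-2,1} both have weight 2 apart from the anomaly of E₂, which contributes
  -- the extra φ_{0,1} term.
  · rw [h.E21_eq]
    have hS0 := JacobiE2.hasJacobiS_phiZero z τ
    have hS2 := JacobiE2.hasJacobiS_phiNegTwo z τ
    have w4 := (JacobiE2.isWeaklyModular_modularForm ModularForm.E₄).S_smul τ
    simp only [hS0, hS2, w4, JacobiE2.E2_S_smul, mul_div_assoc]
    have hτ := τ.ne_zero
    have hs := Complex.two_pi_I_ne_zero
    generalize Complex.exp (2 * Real.pi * Complex.I * (z ^ 2 / τ)) = X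
    generalize 2 * (Real.pi : ℂ) * Complex.I = s at hs
    rw [zpow_neg]
    norm_cast
    field_simp
    ring
  · rw [h.E21_eq]
    have e1 := h1.eq 0 τ
    have e2 := h2.eq 0 τ
    have e3 := h3 τ
    have e4 := h5 τ
    rw [JacobiE2.thetaCoeff] at e3 e4
    simp only [e1, e2, e3, e4]
    ring
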